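/- Let $\mathbb{K}$ be $\mathbb{R}$ or $\mathbb{C}$, and let $\mathrm{cBorn}$ be the category of complete convex bornological $\mathbb{K}$-vector spaces and bounded linear maps, with the completed bornological tensor product $\hat\otimes$. An algebra is an associative, not necessarily unital, algebra $A$ in $(\mathrm{cBorn},\hat\otimes)$. For a right $A$-module $M$ and a left $A$-module $N$ in $\mathrm{cBorn}$, let $M\hat\otimes_A N$ be the coequalizer in $\mathrm{cBorn}$ of the two maps $M\hat\otimes A\hat\otimes N\rightrightarrows M\hat\otimes N$ given by the actions. A left module $M$ is smooth if the map $A\hat\otimes_A M\to M$ induced by the action is an isomorphism, and similarly for right modules; a bimodule is smooth if it is smooth on both sides; $A$ is self-induced if $A\hat\otimes_A A\to A$ is an isomorphism. Let $\mathrm{Mod}(A,B)$ be the category of smooth $A$-$B$-bimodules and bounded bimodule maps. Two self-induced algebras $A$, $B$ are Morita equivalent if they are equivalent in the Morita $2$-category, i.e. if there are $P\in\mathrm{Mod}(A,B)$ and $Q\in\mathrm{Mod}(B,A)$ with $P\hat\otimes_B Q\cong A$ and $Q\hat\otimes_A P\cong B$ as bimodules. An ideal of a self-induced algebra $A$ is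 a strong subobject of $A$ in $\mathrm{Mod}(A,A)$, that is, a subobject represented by a strong monomorphism; ideals are ordered as subobjects. $A$ is simple if $0$ and $A$ are its only ideals. If $A$ and $B$ are Morita equivalent self-induced complete bornological algebras, then the lattices of ideals of $A$ and of $B$ are isomorphic (as ordered sets). In particular, $A$ is simple if and only if $B$ is simple. -/

import Mathlib

open scoped Pointwise
open CategoryTheory

universe u

namespace CBorn

/-! ### Complete convex bornological vector spaces -/

section Spaces

variable (𝕜 : Type) [RCLike 𝕜] {V : Type u} [AddCommGroup V] [Module 𝕜 V]

/-- A disk: a circled and convex subset, i.e. `μ D + ν D ⊆ D` whenever `|μ| + |ν| ≤ 1`. -/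
def IsDisk (D : Set V) : Prop :=
  ∀ x ∈ D, ∀ y ∈ D, ∀ μ ν : 𝕜, ‖μ‖ + ‖ν‖ ≤ 1 → μ • x + ν • y ∈ D

/-- A completant disk `D`: its Minkowski functional is a norm on the span `V_D` of `D`, and `V_D` is
complete in that norm. For `ε > 0` the sets `ε D` are, up to arbitrarily small changes of `ε`, the
balls of radius `ε` about `0` of the Minkowski functional. -/
structure IsCompletantDisk (D : Set V) : Prop where
  isDisk : IsDisk 𝕜 D
  norming : ∀ v : V, (∀ ε : ℝ, 0 < ε → v ∈ (ε : 𝕜) • D) → v = 0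
  complete : ∀ v : ℕ → V, (∀ n, v n ∈ Submodule.span 𝕜 D) →
    (∀ ε : ℝ, 0 < ε → ∃ N, ∀ m ≥ N, ∀ n ≥ N, v m - v n ∈ (ε : 𝕜) • D) →
    ∃ w ∈ Submodule.span 𝕜 D, ∀ ε : ℝ, 0 < ε → ∃ N, ∀ n ≥ N, v n - w ∈ (ε : 𝕜) • D

/-- A complete (convex) bornological vector space: addition and scalar multiplication are bounded
(the field carries its norm bornology), and every bounded set lies in a bounded completant disk. -/
class CompleteBornologicalSpace (V : Type u) [AddCommGroup V] [Module 𝕜 V] [Bornology V] :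
    Prop where
  isBounded_add : ∀ s t : Set V,
    Bornology.IsBounded s → Bornology.IsBounded t → Bornology.IsBounded (s + t)
  isBounded_smul : ∀ (Λ : Set 𝕜) (s : Set V),
    Bornology.IsBounded Λ → Bornology.IsBounded s → Bornology.IsBounded (Λ • s)
  exists_completant : ∀ s : Set V, Bornology.IsBounded s →
    ∃ D : Set V, s ⊆ D ∧ Bornology.IsBounded D ∧ IsCompletantDisk 𝕜 D

end Spaces

/-- A map is bounded if it sends bounded sets to bounded sets. -/
def IsBoundedMap {V W : Type u} [Bornology V] [Bornology W] (f : V → W) : Prop :=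
  ∀ s : Set V, Bornology.IsBounded s → Bornology.IsBounded (f '' s)

/-- Boundedness of a map of two variables, i.e. of a map on the product bornological space. -/
def IsBoundedMap₂ {V W X : Type u} [Bornology V] [Bornology W] [Bornology X]
    (f : V → W → X) : Prop :=
  ∀ (s : Set V) (t : Set W), Bornology.IsBounded s → Bornology.IsBounded t →
    Bornology.IsBounded (Set.image2 f s t)

/-! ### Algebras and tensor products of modules -/

/-- A (not necessarily unital) complete bornological algebra: an algebra whose underlying vector
space is a complete bornological space and whose multiplication is bounded. -/
class CompleteBornologicalAlgebra (𝕜 : Type) [RCLike 𝕜] (A : Type u) [NonUnitalRing A] [Module 𝕜 A]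
    [Bornology A] : Prop extends CompleteBornologicalSpace 𝕜 A where
  smul_mul_assoc : ∀ (c : 𝕜) (a b : A), (c • a) * b = c • (a * b)
  mul_smul_comm : ∀ (c : 𝕜) (a b : A), a * (c • b) = c • (a * b)
  bounded_mul : IsBoundedMap₂ (fun a b : A => a * b)

section Tensor

variable {𝕜 : Type} [RCLike 𝕜]
  {M B N T : Type u}
  [AddCommGroup M] [Module 𝕜 M] [Bornology M]
  [AddCommGroup B] [Module 𝕜 B]
  [AddCommGroup N] [Module 𝕜 N] [Bornology N]
  [AddCommGroup T] [Module 𝕜 T] [Bornology T]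

/-- `B`-tensorial maps: bounded bilinear maps `β : M × N → T` with `β (m b, n) = β (m, b n)`, where
`ρ` is the right action of `B` on `M` and `l` is the left action of `B` on `N`. -/
structure IsTensorial (ρ : M →ₗ[𝕜] B →ₗ[𝕜] M) (l : B →ₗ[𝕜] N →ₗ[𝕜] N)
    (β : M →ₗ[𝕜] N →ₗ[𝕜] T) : Prop where
  bounded : IsBoundedMap₂ (fun m n => β m n)
  balanced : ∀ m b n, β (ρ m b) n = β m (l b n)

/-- The map `τ : M × N → T` exhibits the complete bornological space `T` as the completed tensor
product of `M` and `N` over `B`, i.e. as the coequalizer, in complete bornological spaces, of the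
two maps from the completed tensor product of `M`, `B`, `N` to that of `M`, `N`: every `B`-tensorial
map from `M × N` to a complete bornological space factors uniquely through `τ`. -/
structure IsTensorProductOver (ρ : M →ₗ[𝕜] B →ₗ[𝕜] M) (l : B →ₗ[𝕜] N →ₗ[𝕜] N)
    (τ : M →ₗ[𝕜] N →ₗ[𝕜] T) : Prop where
  complete : CompleteBornologicalSpace 𝕜 T
  tensorial : IsTensorial ρ l τ
  universal : ∀ (X : Type u) [AddCommGroup X] [Module 𝕜 X] [Bornology X]
    [CompleteBornologicalSpace 𝕜 X] (β : M →ₗ[𝕜] N →ₗ[𝕜] X), IsTensorial ρ l β →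
    ∃! f : T →ₗ[𝕜] X, IsBoundedMap f ∧ ∀ m n, f (τ m n) = β m n

end Tensor

section Bimodules

variable (𝕜 : Type) [RCLike 𝕜]

/-- The multiplication of `A` as a bilinear map. -/
def mulMap (A : Type u) [NonUnitalRing A] [Module 𝕜 A] [Bornology A]
    [CompleteBornologicalAlgebra 𝕜 A] : A →ₗ[𝕜] A →ₗ[𝕜] A :=
  LinearMap.mk₂ 𝕜 (fun a b => a * b) add_mul
    (CompleteBornologicalAlgebra.smul_mul_assoc) mul_add
    (CompleteBornologicalAlgebra.mul_smul_comm)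

/-- `A` is self-induced: the multiplication induces an isomorphism from the tensor product of `A`
with itself over `A` to `A`. -/
class SelfInduced (A : Type u) [NonUnitalRing A] [Module 𝕜 A] [Bornology A]
    [CompleteBornologicalAlgebra 𝕜 A] : Prop where
  isTensorProduct : IsTensorProductOver (mulMap 𝕜 A) (mulMap 𝕜 A) (mulMap 𝕜 A)

variable (A B C : Type u)
  [NonUnitalRing A] [Module 𝕜 A] [Bornology A] [CompleteBornologicalAlgebra 𝕜 A]
  [NonUnitalRing B] [Module 𝕜 B] [Bornology B] [CompleteBornologicalAlgebra 𝕜 B]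
  [NonUnitalRing C] [Module 𝕜 C] [Bornology C] [CompleteBornologicalAlgebra 𝕜 C]

/-- Smooth `A`-`B`-bimodules in complete bornological spaces: the left action `A × M → M` exhibits
`M` as the tensor product of `A` and `M` over `A`, and the right action `M × B → M` exhibits `M`
as the tensor product of `M` and `B` over `B`. -/
structure SmoothBimodule where
  carrier : Type u
  [addCommGroup : AddCommGroup carrier]
  [module : Module 𝕜 carrier]
  [bornology : Bornology carrier]
  [complete : CompleteBornologicalSpace 𝕜 carrier]
  /-- the left action -/
  lact : A →ₗ[𝕜] carrier →ₗ[𝕜] carrier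
  /-- the right action -/
  ract : carrier →ₗ[𝕜] B →ₗ[𝕜] carrier
  bounded_lact : IsBoundedMap₂ (fun a m => lact a m)
  bounded_ract : IsBoundedMap₂ (fun m b => ract m b)
  mul_lact : ∀ a a' m, lact (a * a') m = lact a (lact a' m)
  ract_mul : ∀ m b b', ract m (b * b') = ract (ract m b) b'
  lact_ract : ∀ a m b, ract (lact a m) b = lact a (ract m b)
  smooth_left : IsTensorProductOver (mulMap 𝕜 A) lact lact
  smooth_right : IsTensorProductOver ract (mulMap 𝕜 B) ract

attribute [instance] SmoothBimodule.addCommGroup SmoothBimodule.module SmoothBimodule.bornology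
  SmoothBimodule.complete

variable {𝕜 A B C}

/-- Morphisms of bimodules: bounded linear maps that commute with both actions. -/
@[ext]
structure SmoothBimodule.Hom (M N : SmoothBimodule 𝕜 A B) where
  toLinearMap : M.carrier →ₗ[𝕜] N.carrier
  bounded : IsBoundedMap toLinearMap
  map_lact : ∀ a m, toLinearMap (M.lact a m) = N.lact a (toLinearMap m)
  map_ract : ∀ m b, toLinearMap (M.ract m b) = N.ract (toLinearMap m) b

/-- The category `Mod(A, B)` of smooth bimodules. -/
instance : Category.{u} (SmoothBimodule.{u} 𝕜 A B) where
  Hom M N := SmoothBimodule.Hom M N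
  id M := ⟨LinearMap.id, fun s hs => by simpa using hs, fun _ _ => rfl, fun _ _ => rfl⟩
  comp f g := ⟨g.toLinearMap ∘ₗ f.toLinearMap,
    fun s hs => by
      have h := g.bounded _ (f.bounded s hs)
      rwa [Set.image_image] at h,
    fun a m => by simp [f.map_lact, g.map_lact],
    fun m b => by simp [f.map_ract, g.map_ract]⟩

/-- The map `τ : P × Q → T` exhibits the smooth `A`-`C`-bimodule `T` as the composite of `P` and
`Q`, i.e. as their tensor product over `B` with the induced bimodule structure. -/
structure IsComposite (P : SmoothBimodule 𝕜 A B) (Q : SmoothBimodule 𝕜 B C)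
    (T : SmoothBimodule 𝕜 A C) (τ : P.carrier →ₗ[𝕜] Q.carrier →ₗ[𝕜] T.carrier) : Prop where
  isTensorProduct : IsTensorProductOver P.ract Q.lact τ
  map_lact : ∀ a p q, τ (P.lact a p) q = T.lact a (τ p q)
  map_ract : ∀ p q c, τ p (Q.ract q c) = T.ract (τ p q) c

variable (𝕜 A B) [SelfInduced 𝕜 A] [SelfInduced 𝕜 B]

/-- A self-induced algebra as a smooth bimodule over itself. It is the identity of `A` in the
Morita 2-category. -/
def regular : SmoothBimodule 𝕜 A A where
  carrier := A
  lact := mulMap 𝕜 A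
  ract := mulMap 𝕜 A
  bounded_lact := CompleteBornologicalAlgebra.bounded_mul 𝕜
  bounded_ract := CompleteBornologicalAlgebra.bounded_mul 𝕜
  mul_lact := mul_assoc
  ract_mul := fun m b b' => (mul_assoc m b b').symm
  lact_ract := mul_assoc
  smooth_left := SelfInduced.isTensorProduct
  smooth_right := SelfInduced.isTensorProduct

/-- Morita equivalence of self-induced complete bornological algebras, i.e. weak isomorphism in the
Morita 2-category: there are smooth bimodules `P ∈ Mod(A, B)` and `Q ∈ Mod(B, A)` whose composites
are isomorphic, as bimodules, to the identity bimodules `A` and `B`. -/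
def MoritaEquivalent : Prop :=
  ∃ (P : SmoothBimodule 𝕜 A B) (Q : SmoothBimodule 𝕜 B A),
    (∃ (T : SmoothBimodule 𝕜 A A) (τ : P.carrier →ₗ[𝕜] Q.carrier →ₗ[𝕜] T.carrier),
      IsComposite P Q T τ ∧ Nonempty (T ≅ regular 𝕜 A)) ∧
    (∃ (S : SmoothBimodule 𝕜 B B) (σ : Q.carrier →ₗ[𝕜] P.carrier →ₗ[𝕜] S.carrier),
      IsComposite Q P S σ ∧ Nonempty (S ≅ regular 𝕜 B))

/-- Ideals of `A`: strong subobjects of `A` in the category of smooth `A`-`A`-bimodules, ordered by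
the order of subobjects. -/
abbrev SmoothIdeal : Type (u + 1) :=
  {I : Subobject (regular 𝕜 A) // StrongMono I.arrow}

/-- `A` is simple if `0` and `A` are its only ideals. -/
def IsSimpleAlg : Prop :=
  ∀ I : SmoothIdeal 𝕜 A, Subsingleton (I.1 : SmoothBimodule 𝕜 A A).carrier ∨ I.1 = ⊤

end Bimodules

end CBorn

namespace CBorn

section Disks

variable {𝕜 : Type} [RCLike 𝕜] {V W X : Type u} [AddCommGroup V] [Module 𝕜 V]
  [AddCommGroup W] [Module 𝕜 W] [AddCommGroup X] [Module 𝕜 X]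

theorem IsDisk.add_mem {D : Set V} (hD : IsDisk 𝕜 D) {ε δ : ℝ} (hε : 0 ≤ ε) (hδ : 0 ≤ δ)
    (h : 0 < ε + δ) {x y : V} (hx : x ∈ (ε : 𝕜) • D) (hy : y ∈ (δ : 𝕜) • D) :
    x + y ∈ ((ε + δ : ℝ) : 𝕜) • D := by
  obtain ⟨a, ha, rfl⟩ := hx
  obtain ⟨b, hb, rfl⟩ := hy
  have h0 : ((ε + δ : ℝ) : 𝕜) ≠ 0 := by exact_mod_cast h.ne'
  refine ⟨((ε / (ε + δ) : ℝ) : 𝕜) • a + ((δ / (ε + δ) : ℝ) : 𝕜) • b, hD a ha b hb _ _ ?_, ?_⟩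
  · rw [RCLike.norm_of_nonneg (by positivity), RCLike.norm_of_nonneg (by positivity), ← add_div,
      div_self h.ne']
  · simp only [smul_add, smul_smul, ← RCLike.ofReal_mul, mul_div_cancel₀ _ h.ne']

theorem IsDisk.smul_mem {D : Set V} (hD : IsDisk 𝕜 D) {x : V} (hx : x ∈ D) {c : 𝕜}
    (hc : ‖c‖ ≤ 1) : c • x ∈ D := by
  simpa using hD x hx x hx c 0 (by simpa using hc)

theorem IsDisk.neg_mem {D : Set V} (hD : IsDisk 𝕜 D) {c : 𝕜} {x : V}
    (hx : x ∈ c • D) : -x ∈ c • D := by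
  obtain ⟨a, ha, rfl⟩ := hx
  exact ⟨-a, by simpa using hD.smul_mem ha (c := -1) (by simp), by simp⟩

theorem IsDisk.smul_mem_smul {D : Set V} (hD : IsDisk 𝕜 D) {x : V} (hx : x ∈ D) {c : 𝕜} {r : ℝ}
    (hr : 0 < r) (hc : ‖c‖ ≤ r) : c • x ∈ (r : 𝕜) • D := by
  have h0 : (r : 𝕜) ≠ 0 := by exact_mod_cast hr.ne'
  refine ⟨((r : 𝕜)⁻¹ * c) • x, hD.smul_mem hx ?_, ?_⟩
  · rw [norm_mul, norm_inv, RCLike.norm_of_nonneg hr.le, inv_mul_le_iff₀ hr, mul_one]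
    exact hc
  · simp [smul_smul, mul_inv_cancel_left₀ h0]

theorem IsDisk.mono {D : Set V} (hD : IsDisk 𝕜 D) {ε δ : ℝ} (hε : 0 ≤ ε) (hδ : 0 < δ) (h : ε ≤ δ)
    {x : V} (hx : x ∈ (ε : 𝕜) • D) : x ∈ (δ : 𝕜) • D := by
  obtain ⟨a, ha, rfl⟩ := hx
  exact hD.smul_mem_smul ha hδ (by rwa [RCLike.norm_of_nonneg hε])

theorem IsDisk.sum_mem {D : Set V} (hD : IsDisk 𝕜 D) {E : Type u} (c : E → 𝕜)
    (v : E → V) (t : Finset E) (hv : ∀ e ∈ t, c e ≠ 0 → v e ∈ D) {r : ℝ} (hr : 0 < r)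
    (h0 : (0 : V) ∈ D) (hc : ∑ e ∈ t, ‖c e‖ ≤ r) : ∑ e ∈ t, c e • v e ∈ (r : 𝕜) • D := by
  classical
  induction t using Finset.induction_on generalizing r with
  | empty => exact ⟨0, h0, by simp⟩
  | insert a t ha ih =>
    rw [Finset.sum_insert ha] at hc ⊢
    have hvt : ∀ e ∈ t, c e ≠ 0 → v e ∈ D := fun e he => hv e (Finset.mem_insert_of_mem he)
    by_cases hca : c a = 0
    · simp only [hca, zero_smul, zero_add]
      exact ih hvt hr (by simpa [hca] using hc)
    · have hva := hv a (Finset.mem_insert_self a t) hca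
      have hpos : 0 < ‖c a‖ := norm_pos_iff.2 hca
      have h1 : c a • v a ∈ ((‖c a‖ : ℝ) : 𝕜) • D := hD.smul_mem_smul hva hpos le_rfl
      by_cases hs : ∑ e ∈ t, ‖c e‖ = 0
      · have : ∀ e ∈ t, c e • v e = 0 := fun e he => by
          rw [Finset.sum_eq_zero_iff_of_nonneg (fun _ _ => norm_nonneg _)] at hs
          rw [norm_eq_zero.1 (hs e he), zero_smul]
        rw [Finset.sum_eq_zero this, add_zero]
        exact hD.mono hpos.le hr (by linarith) h1
      · have hs' : 0 < ∑ e ∈ t, ‖c e‖ :=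
          lt_of_le_of_ne (Finset.sum_nonneg fun _ _ => norm_nonneg _) (Ne.symm hs)
        exact hD.mono (by positivity) hr hc
          (hD.add_mem hpos.le hs'.le (by positivity) h1 (ih hvt hs' le_rfl))

/-- The image of a closed ball under an injective linear map out of a Banach space. -/
theorem isCompletantDisk_image_closedBall {Y : Type u} [NormedAddCommGroup Y] [NormedSpace 𝕜 Y]
    [CompleteSpace Y] (j : Y →ₗ[𝕜] V) (hj : Function.Injective j) {r : ℝ} (hr : 0 < r) :
    IsCompletantDisk 𝕜 (j '' Metric.closedBall 0 r) := by
  have key : ∀ (ε : ℝ), 0 < ε → ∀ y : Y, j y ∈ (ε : 𝕜) • j '' Metric.closedBall 0 r ↔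
      ‖y‖ ≤ ε * r := by
    intro ε hε y
    have h0 : (ε : 𝕜) ≠ 0 := by exact_mod_cast hε.ne'
    constructor
    · rintro ⟨_, ⟨z, hz, rfl⟩, h⟩
      simp only [← map_smul] at h
      rw [← hj h, norm_smul, RCLike.norm_of_nonneg hε.le]
      exact mul_le_mul_of_nonneg_left (by simpa using hz) hε.le
    · intro h
      refine ⟨_, ⟨(ε : 𝕜)⁻¹ • y, ?_, rfl⟩, by simp [smul_smul, mul_inv_cancel₀ h0]⟩
      rw [mem_closedBall_zero_iff, norm_smul, norm_inv, RCLike.norm_of_nonneg hε.le,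
        inv_mul_le_iff₀ hε]
      exact h
  have hspan : ∀ v ∈ Submodule.span 𝕜 (j '' Metric.closedBall 0 r), ∃ y, j y = v := by
    intro v hv
    have : Submodule.span 𝕜 (j '' Metric.closedBall 0 r) ≤ LinearMap.range j :=
      Submodule.span_le.2 (by rintro _ ⟨y, -, rfl⟩; exact ⟨y, rfl⟩)
    exact this hv
  refine ⟨?_, ?_, ?_⟩
  · rintro _ ⟨x, hx, rfl⟩ _ ⟨y, hy, rfl⟩ μ ν h
    refine ⟨μ • x + ν • y, ?_, by simp⟩
    rw [mem_closedBall_zero_iff] at *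
    calc ‖μ • x + ν • y‖ ≤ ‖μ‖ * ‖x‖ + ‖ν‖ * ‖y‖ :=
          (norm_add_le _ _).trans (by rw [norm_smul, norm_smul])
      _ ≤ ‖μ‖ * r + ‖ν‖ * r := by gcongr
      _ = (‖μ‖ + ‖ν‖) * r := by ring
      _ ≤ 1 * r := by gcongr
      _ = r := one_mul r
  · intro v hv
    obtain ⟨_, ⟨y, -, rfl⟩, rfl⟩ := hv 1 one_pos
    have hy : ∀ ε : ℝ, 0 < ε → ‖y‖ ≤ ε * r := fun ε hε => by
      rw [← key ε hε]
      simpa using hv ε hε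
    have : y = 0 := norm_le_zero_iff.1 (le_of_forall_pos_le_add fun ε hε => by
      have := hy (ε / r) (by positivity)
      rw [div_mul_cancel₀ _ hr.ne'] at this
      linarith)
    simp [this]
  · intro v hv hc
    choose y hy using fun n => hspan (v n) (hv n)
    obtain rfl : (fun n => j (y n)) = v := funext hy
    have hcy : CauchySeq y := by
      rw [Metric.cauchySeq_iff]
      intro ε hε
      obtain ⟨N, hN⟩ := hc (ε / 2 / r) (by positivity)
      refine ⟨N, fun m hm n hn => ?_⟩
      have := hN m hm n hn
      rw [← map_sub, key _ (by positivity), div_mul_cancel₀ _ hr.ne'] at this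
      rw [dist_eq_norm]
      linarith
    obtain ⟨w, hw⟩ := cauchySeq_tendsto_of_complete hcy
    have hsp : j w ∈ Submodule.span 𝕜 (j '' Metric.closedBall 0 r) := by
      have hpos : (0 : ℝ) < ‖w‖ / r + 1 := by positivity
      obtain ⟨d, hd, hdw⟩ := (key (‖w‖ / r + 1) hpos w).2 (by
        rw [add_mul, div_mul_cancel₀ _ hr.ne']; linarith)
      rw [← hdw]
      exact Submodule.smul_mem _ _ (Submodule.subset_span hd)
    refine ⟨j w, hsp, fun ε hε => ?_⟩
    obtain ⟨N, hN⟩ := Metric.tendsto_atTop.1 hw (ε * r) (by positivity)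
    refine ⟨N, fun n hn => ?_⟩
    have := hN n hn
    rw [← map_sub, key ε hε]
    rw [dist_eq_norm] at this
    exact this.le

theorem exists_isCompletantDisk_of_isClosed_ker {Y : Type u} [NormedAddCommGroup Y]
    [NormedSpace 𝕜 Y] [CompleteSpace Y] (q : Y →ₗ[𝕜] V) (hq : IsClosed (LinearMap.ker q : Set Y))
    {r : ℝ} (hr : 0 < r) :
    ∃ D : Set V, q '' Metric.closedBall 0 r ⊆ D ∧ D ⊆ q '' Metric.closedBall 0 (r + 1) ∧
      IsCompletantDisk 𝕜 D := by
  have hinj : Function.Injective ((LinearMap.ker q).liftQ q le_rfl) := by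
    rw [← LinearMap.ker_eq_bot]
    exact Submodule.ker_liftQ_eq_bot _ _ _ le_rfl
  refine ⟨_, ?_, ?_, isCompletantDisk_image_closedBall _ hinj hr⟩
  · rintro _ ⟨y, hy, rfl⟩
    rw [mem_closedBall_zero_iff] at hy
    refine ⟨(LinearMap.ker q).mkQ y, ?_, rfl⟩
    rw [mem_closedBall_zero_iff]
    exact (Submodule.Quotient.norm_mk_le _ _).trans hy
  · rintro _ ⟨y, hy, rfl⟩
    rw [mem_closedBall_zero_iff] at hy
    obtain ⟨f, rfl, hf⟩ := Submodule.Quotient.norm_mk_lt y one_pos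
    refine ⟨f, ?_, rfl⟩
    rw [mem_closedBall_zero_iff]
    exact hf.le.trans (by gcongr)

end Disks

section Bounded

open Bornology

variable {𝕜 : Type} [RCLike 𝕜] {V W X : Type u} [AddCommGroup V] [Module 𝕜 V] [Bornology V]
  [AddCommGroup W] [Module 𝕜 W] [Bornology W] [AddCommGroup X] [Module 𝕜 X] [Bornology X]

section

variable (𝕜) [CompleteBornologicalSpace 𝕜 V]

theorem exists_completant_zero_mem {s : Set V} (hs : IsBounded s) :
    ∃ D : Set V, s ⊆ D ∧ (0 : V) ∈ D ∧ IsBounded D ∧ IsCompletantDisk 𝕜 D := by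
  obtain ⟨D, h, hb, hD⟩ := CompleteBornologicalSpace.exists_completant (𝕜 := 𝕜) (s ∪ {0})
    (hs.union isBounded_singleton)
  exact ⟨D, fun x hx => h (Or.inl hx), h (Or.inr rfl), hb, hD⟩

theorem isBounded_const_smul {s : Set V} (hs : IsBounded s) (c : 𝕜) : IsBounded (c • s) := by
  have := CompleteBornologicalSpace.isBounded_smul (𝕜 := 𝕜) {c} s isBounded_singleton hs
  rwa [Set.singleton_smul] at this

theorem isBounded_add (𝕜 : Type) [RCLike 𝕜] [Module 𝕜 V] [CompleteBornologicalSpace 𝕜 V]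
    {s t : Set V} (hs : IsBounded s) (ht : IsBounded t) :
    IsBounded (s + t) :=
  CompleteBornologicalSpace.isBounded_add 𝕜 s t hs ht

/-- Complete bornological spaces are separated. -/
theorem eq_zero_of_forall_mem_smul {s : Set V} (hs : IsBounded s) {v : V}
    (h : ∀ ε : ℝ, 0 < ε → v ∈ (ε : 𝕜) • s) : v = 0 := by
  obtain ⟨D, hsD, -, -, hD⟩ := exists_completant_zero_mem 𝕜 hs
  exact hD.norming v fun ε hε => Set.smul_set_mono hsD (h ε hε)

end

theorem IsBoundedMap.comp {V W X : Type u} [Bornology V] [Bornology W] [Bornology X]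
    {g : W → X} {f : V → W} (hg : IsBoundedMap g) (hf : IsBoundedMap f) :
    IsBoundedMap (fun v => g (f v)) := fun s hs => by
  have := hg _ (hf s hs)
  rwa [Set.image_image] at this

theorem IsBoundedMap₂.comp {V W X V' W' : Type u} [Bornology V] [Bornology W] [Bornology X]
    [Bornology V'] [Bornology W'] {β : V → W → X} (hβ : IsBoundedMap₂ β) {f : V' → V} {g : W' → W}
    (hf : IsBoundedMap f) (hg : IsBoundedMap g) : IsBoundedMap₂ (fun v w => β (f v) (g w)) :=
  fun s t hs ht => (hβ _ _ (hf s hs) (hg t ht)).subset (by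
    rintro _ ⟨a, ha, b, hb, rfl⟩
    exact ⟨_, ⟨a, ha, rfl⟩, _, ⟨b, hb, rfl⟩, rfl⟩)

theorem IsBoundedMap.comp₂ {V W X Y : Type u} [Bornology V] [Bornology W] [Bornology X]
    [Bornology Y] {g : X → Y} {β : V → W → X} (hg : IsBoundedMap g) (hβ : IsBoundedMap₂ β) :
    IsBoundedMap₂ (fun v w => g (β v w)) :=
  fun s t hs ht => (hg _ (hβ s t hs ht)).subset (by
    rintro _ ⟨a, ha, b, hb, rfl⟩
    exact ⟨_, ⟨a, ha, b, hb, rfl⟩, rfl⟩)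

theorem isBoundedMap_id {V : Type u} [Bornology V] : IsBoundedMap (fun v : V => v) :=
  fun s hs => by simpa using hs

theorem IsBoundedMap₂.flip {V W X : Type u} [Bornology V] [Bornology W] [Bornology X]
    {β : V → W → X} (hβ : IsBoundedMap₂ β) : IsBoundedMap₂ (fun w v => β v w) :=
  fun s t hs ht => (hβ t s ht hs).subset (by
    rintro _ ⟨a, ha, b, hb, rfl⟩
    exact ⟨b, hb, a, ha, rfl⟩)

theorem IsBoundedMap₂.apply_left {V W X : Type u} [Bornology V] [Bornology W] [Bornology X]
    {β : V → W → X} (hβ : IsBoundedMap₂ β) (v : V) : IsBoundedMap (β v) :=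
  fun s hs => (hβ {v} s isBounded_singleton hs).subset (by
    rintro _ ⟨a, ha, rfl⟩
    exact ⟨v, rfl, a, ha, rfl⟩)

theorem IsBoundedMap₂.apply_right {V W X : Type u} [Bornology V] [Bornology W] [Bornology X]
    {β : V → W → X} (hβ : IsBoundedMap₂ β) (w : W) : IsBoundedMap (fun v => β v w) :=
  hβ.flip.apply_left w

theorem isBoundedMap_add [CompleteBornologicalSpace 𝕜 X] {f g : V →ₗ[𝕜] X} (hf : IsBoundedMap f)
    (hg : IsBoundedMap g) : IsBoundedMap (f + g) := fun s hs =>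
  (isBounded_add 𝕜 (hf s hs) (hg s hs)).subset (by
    rintro _ ⟨a, ha, rfl⟩
    exact ⟨_, ⟨a, ha, rfl⟩, _, ⟨a, ha, rfl⟩, rfl⟩)

theorem isBoundedMap_smul [CompleteBornologicalSpace 𝕜 X] {f : V →ₗ[𝕜] X} (hf : IsBoundedMap f)
    (c : 𝕜) : IsBoundedMap (c • f) := fun s hs =>
  (isBounded_const_smul 𝕜 (hf s hs) c).subset (by
    rintro _ ⟨a, ha, rfl⟩
    exact ⟨_, ⟨a, ha, rfl⟩, rfl⟩)

theorem isBoundedMap_zero : IsBoundedMap (0 : V →ₗ[𝕜] X) := fun s _ =>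
  (isBounded_singleton (x := (0 : X))).subset (by
    rintro _ ⟨a, ha, rfl⟩
    rfl)

end Bounded

/-! ### Uniformly bounded functions -/

section UniformlyBounded

open Bornology

variable (𝕜 : Type) [RCLike 𝕜] (S X : Type u) [AddCommGroup X] [Module 𝕜 X] [Bornology X]
  [CompleteBornologicalSpace 𝕜 X]

/-- The functions from a set to a complete bornological space with bounded range. -/
def boundedFunctions : Submodule 𝕜 (S → X) where
  carrier := {h | IsBounded (Set.range h)}
  add_mem' {f g} hf hg := (isBounded_add 𝕜 hf hg).subset (by
    rintro _ ⟨a, rfl⟩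
    exact ⟨_, ⟨a, rfl⟩, _, ⟨a, rfl⟩, rfl⟩)
  zero_mem' := (isBounded_singleton (x := (0 : X))).subset (by
    rintro _ ⟨a, rfl⟩
    rfl)
  smul_mem' c f hf := (isBounded_const_smul 𝕜 hf c).subset (by
    rintro _ ⟨a, rfl⟩
    exact ⟨_, ⟨a, rfl⟩, rfl⟩)

/-- The functions with bounded range, with the bornology of uniform boundedness. -/
def UniformFunctions : Type u := boundedFunctions 𝕜 S X

namespace UniformFunctions

noncomputable instance : AddCommGroup (UniformFunctions 𝕜 S X) :=
  inferInstanceAs (AddCommGroup (boundedFunctions 𝕜 S X))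

noncomputable instance : Module 𝕜 (UniformFunctions 𝕜 S X) :=
  inferInstanceAs (Module 𝕜 (boundedFunctions 𝕜 S X))

variable {𝕜 S X}

/-- Evaluation at a point. -/
noncomputable def eval (a : S) : UniformFunctions 𝕜 S X →ₗ[𝕜] X :=
  LinearMap.proj a ∘ₗ (boundedFunctions 𝕜 S X).subtype

theorem ext {f g : UniformFunctions 𝕜 S X} (h : ∀ a, eval a f = eval a g) : f = g :=
  Subtype.ext (funext h)

theorem isBounded_range (f : UniformFunctions 𝕜 S X) :
    IsBounded (Set.range fun a => eval a f) := f.2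

/-- The function with given values. -/
noncomputable def mk (f : S → X) (hf : IsBounded (Set.range f)) : UniformFunctions 𝕜 S X := ⟨f, hf⟩

@[simp]
theorem eval_mk (f : S → X) (hf : IsBounded (Set.range f)) (a : S) :
    eval a (mk (𝕜 := 𝕜) f hf) = f a := rfl

instance : Bornology (UniformFunctions 𝕜 S X) :=
  Bornology.ofBounded {s | ∃ D : Set X, IsBounded D ∧ ∀ f ∈ s, ∀ a, eval a f ∈ D}
    ⟨∅, isBounded_empty, by simp⟩
    (fun s ⟨D, hD, h⟩ t hts => ⟨D, hD, fun f hf => h f (hts hf)⟩)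
    (fun s ⟨D, hD, h⟩ t ⟨D', hD', h'⟩ => ⟨D ∪ D', hD.union hD', by
      rintro f (hf | hf) a
      exacts [Or.inl (h f hf a), Or.inr (h' f hf a)]⟩)
    (fun f => ⟨_, f.isBounded_range, by rintro _ rfl a; exact ⟨a, rfl⟩⟩)

theorem isBounded_iff {s : Set (UniformFunctions 𝕜 S X)} :
    IsBounded s ↔ ∃ D : Set X, IsBounded D ∧ ∀ f ∈ s, ∀ a, eval a f ∈ D :=
  isBounded_ofBounded_iff _

theorem isBoundedMap_eval (a : S) :
    IsBoundedMap (eval a : UniformFunctions 𝕜 S X →ₗ[𝕜] X) := fun s hs => by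
  obtain ⟨D, hD, h⟩ := isBounded_iff.1 hs
  exact hD.subset (by rintro _ ⟨f, hf, rfl⟩; exact h f hf a)

theorem isCompletantDisk {D : Set X} (hb : IsBounded D) (hD : IsCompletantDisk 𝕜 D) :
    IsCompletantDisk 𝕜 {f : UniformFunctions 𝕜 S X | ∀ a, eval a f ∈ D} := by
  have key : ∀ (ε : ℝ) (f : UniformFunctions 𝕜 S X), 0 < ε →
      (f ∈ (ε : 𝕜) • {f : UniformFunctions 𝕜 S X | ∀ a, eval a f ∈ D} ↔
        ∀ a, eval a f ∈ (ε : 𝕜) • D) := by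
    intro ε f hε
    have h0 : (ε : 𝕜) ≠ 0 := by exact_mod_cast hε.ne'
    simp [Set.mem_smul_set_iff_inv_smul_mem₀ h0]
  refine ⟨?_, ?_, ?_⟩
  · intro f hf g hg μ ν h a
    simpa using hD.isDisk _ (hf a) _ (hg a) μ ν h
  · intro f hf
    exact ext fun a => by
      rw [map_zero]
      exact hD.norming _ fun ε hε => (key ε f hε).1 (hf ε hε) a
  · intro v hv hc
    have hvD : ∀ n a, eval a (v n) ∈ Submodule.span 𝕜 D := fun n a => by
      have : Submodule.span 𝕜 {f : UniformFunctions 𝕜 S X | ∀ a, eval a f ∈ D} ≤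
          (Submodule.span 𝕜 D).comap (eval a) :=
        Submodule.span_le.2 fun f hf => Submodule.subset_span (hf a)
      exact this (hv n)
    have hlim := fun a => hD.complete (fun n => eval a (v n)) (fun n => hvD n a)
      (fun ε hε => by
        obtain ⟨N, hN⟩ := hc ε hε
        refine ⟨N, fun m hm n hn => ?_⟩
        simpa using (key ε _ hε).1 (hN m hm n hn) a)
    choose w hw hwlim using hlim
    have hconv : ∀ ε : ℝ, 0 < ε → ∃ N, ∀ n ≥ N, ∀ a, eval a (v n) - w a ∈ (ε : 𝕜) • D := by
      intro ε hε
      obtain ⟨N, hN⟩ := hc (ε / 2) (by positivity)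
      refine ⟨N, fun n hn a => ?_⟩
      obtain ⟨M, hM⟩ := hwlim a (ε / 2) (by positivity)
      have h1 := (key (ε / 2) _ (by positivity)).1 (hN n hn (max N M) (le_max_left _ _)) a
      have h2 := hM (max N M) (le_max_right _ _)
      have h3 := hD.isDisk.add_mem (by positivity) (by positivity) (by positivity) h1 h2
      simpa using h3
    obtain ⟨N, hN⟩ := hconv 1 one_pos
    have hwb : IsBounded (Set.range w) := by
      refine (isBounded_add 𝕜 (v N).isBounded_range hb).subset ?_
      rintro _ ⟨a, rfl⟩
      have h1 := hD.isDisk.neg_mem (hN N le_rfl a)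
      rw [RCLike.ofReal_one, one_smul, neg_sub] at h1
      exact ⟨_, ⟨a, rfl⟩, _, h1, by simp⟩
    refine ⟨mk w hwb, ?_, fun ε hε => ?_⟩
    · have h2 : v N - mk w hwb ∈ {f : UniformFunctions 𝕜 S X | ∀ a, eval a f ∈ D} := fun a => by
        simpa using hN N le_rfl a
      have := Submodule.sub_mem _ (hv N) (Submodule.subset_span (R := 𝕜) h2)
      simpa using this
    · obtain ⟨N, hN⟩ := hconv ε hε
      refine ⟨N, fun n hn => (key ε _ hε).2 fun a => ?_⟩
      simpa using hN n hn a

instance : CompleteBornologicalSpace 𝕜 (UniformFunctions 𝕜 S X) where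
  isBounded_add s t hs ht := by
    obtain ⟨D, hD, h⟩ := isBounded_iff.1 hs
    obtain ⟨D', hD', h'⟩ := isBounded_iff.1 ht
    refine isBounded_iff.2 ⟨_, isBounded_add 𝕜 hD hD', ?_⟩
    rintro _ ⟨f, hf, g, hg, rfl⟩ a
    exact ⟨_, h f hf a, _, h' g hg a, by simp⟩
  isBounded_smul Λ s hΛ hs := by
    obtain ⟨D, hD, h⟩ := isBounded_iff.1 hs
    refine isBounded_iff.2 ⟨_, CompleteBornologicalSpace.isBounded_smul Λ D hΛ hD, ?_⟩
    rintro _ ⟨c, hc, f, hf, rfl⟩ a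
    exact ⟨c, hc, _, h f hf a, by simp⟩
  exists_completant s hs := by
    obtain ⟨B, hB, h⟩ := isBounded_iff.1 hs
    obtain ⟨D, hBD, -, hDb, hD⟩ := exists_completant_zero_mem 𝕜 hB
    exact ⟨_, fun f hf a => hBD (h f hf a), isBounded_iff.2 ⟨D, hDb, fun f hf => hf⟩,
      isCompletantDisk hDb hD⟩

end UniformFunctions

end UniformlyBounded

end CBorn

namespace CBorn

open Bornology

/-! ### Absolutely convergent sums -/

section Sums

variable {𝕜 : Type} [RCLike 𝕜] {E X : Type u} [AddCommGroup X] [Module 𝕜 X]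

/-- The net of partial sums of `∑ e, c e • b e` converges to `x` in the gauge of `D`. -/
def HasSumIn (D : Set X) (c : E → 𝕜) (b : E → X) (x : X) : Prop :=
  ∀ ε : ℝ, 0 < ε → ∃ s : Finset E, ∀ t, s ⊆ t → ∑ e ∈ t, c e • b e - x ∈ (ε : 𝕜) • D

theorem IsCompletantDisk.exists_hasSumIn {D : Set X} (hD : IsCompletantDisk 𝕜 D)
    (h0 : (0 : X) ∈ D) {c : E → 𝕜} {b : E → X} (hc : Summable fun e => ‖c e‖)
    (hb : ∀ e, c e ≠ 0 → b e ∈ D) : ∃ x, HasSumIn D c b x := by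
  classical
  have hvan : ∀ n : ℕ, ∃ s : Finset E, ∀ t, Disjoint t s → ∑ e ∈ t, ‖c e‖ ≤ 1 / ((n : ℝ) + 1) := by
    intro n
    obtain ⟨s, hs⟩ := summable_iff_vanishing_norm.1 hc (1 / ((n : ℝ) + 1)) (by positivity)
    exact ⟨s, fun t ht => (le_abs_self _).trans (hs t ht).le⟩
  choose s hs using hvan
  have hmem : ∀ (n : ℕ) (t : Finset E), Disjoint t (s n) →
      ∑ e ∈ t, c e • b e ∈ ((1 / ((n : ℝ) + 1) : ℝ) : 𝕜) • D := fun n t ht =>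
    hD.isDisk.sum_mem c b t (fun e _ => hb e) (by positivity) h0 (hs n t ht)
  have hsub : ∀ t t' : Finset E, ∑ e ∈ t, c e • b e - ∑ e ∈ t', c e • b e =
      ∑ e ∈ t \ t', c e • b e + -∑ e ∈ t' \ t, c e • b e := by
    intro t t'
    rw [← sub_eq_add_neg]
    exact (Finset.sum_sdiff_sub_sum_sdiff ..).symm
  have hsmall : ∀ ε : ℝ, 0 < ε → ∃ N : ℕ, ∀ n ≥ N, 1 / ((n : ℝ) + 1) ≤ ε := by
    intro ε hε
    obtain ⟨N, hN⟩ := exists_nat_one_div_lt hε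
    exact ⟨N, fun n hn => (one_div_le_one_div_of_le (by positivity) (by gcongr)).trans hN.le⟩
  obtain ⟨x, -, hx⟩ := hD.complete (fun n => ∑ e ∈ s n, c e • b e)
    (fun n => Submodule.sum_mem _ fun e _ => by
      by_cases h : c e = 0
      · simp [h]
      · exact Submodule.smul_mem _ _ (Submodule.subset_span (hb e h)))
    (fun ε hε => by
      obtain ⟨N, hN⟩ := hsmall (ε / 2) (by positivity)
      refine ⟨N, fun m hm n hn => ?_⟩
      rw [hsub]
      have h1 := hmem n (s m \ s n) Finset.sdiff_disjoint
      have h2 := hD.isDisk.neg_mem (hmem m (s n \ s m) Finset.sdiff_disjoint)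
      have h3 := hD.isDisk.add_mem (by positivity) (by positivity) (by positivity) h1 h2
      exact hD.isDisk.mono (by positivity) hε (by linarith [hN m hm, hN n hn]) h3)
  refine ⟨x, fun ε hε => ?_⟩
  obtain ⟨N, hN⟩ := hsmall (ε / 2) (by positivity)
  obtain ⟨M, hM⟩ := hx (ε / 2) (by positivity)
  refine ⟨s (max N M), fun t ht => ?_⟩
  have h1 := hmem (max N M) (t \ s (max N M)) Finset.sdiff_disjoint
  have h2 := hM (max N M) (le_max_right _ _)
  have h3 := hD.isDisk.add_mem (by positivity) (by positivity) (by positivity) h1 h2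
  have h4 : ∑ e ∈ t, c e • b e - x = ∑ e ∈ t \ s (max N M), c e • b e +
      (∑ e ∈ s (max N M), c e • b e - x) := by
    rw [← Finset.sum_sdiff ht]
    abel
  rw [h4]
  exact hD.isDisk.mono (by positivity) hε (by linarith [hN _ (le_max_left N M)]) h3

theorem HasSumIn.mono {D D' : Set X} (h : D ⊆ D') {c : E → 𝕜} {b : E → X} {x : X}
    (hx : HasSumIn D c b x) : HasSumIn D' c b x := fun ε hε => by
  obtain ⟨s, hs⟩ := hx ε hε
  exact ⟨s, fun t ht => Set.smul_set_mono h (hs t ht)⟩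

variable [Bornology X]

/-- Convergence of sums in a bornological space. -/
def HasBornSum (c : E → 𝕜) (b : E → X) (x : X) : Prop :=
  ∃ D : Set X, IsBounded D ∧ HasSumIn D c b x

variable [CompleteBornologicalSpace 𝕜 X]

theorem HasBornSum.common {c c' : E → 𝕜} {b b' : E → X} {x x' : X}
    (h : HasBornSum c b x) (h' : HasBornSum c' b' x') :
    ∃ D : Set X, IsBounded D ∧ IsCompletantDisk 𝕜 D ∧ HasSumIn D c b x ∧ HasSumIn D c' b' x' := by
  obtain ⟨D, hD, h⟩ := h
  obtain ⟨D', hD', h'⟩ := h'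
  obtain ⟨B, hB, -, hBb, hBc⟩ := exists_completant_zero_mem 𝕜 (hD.union hD')
  exact ⟨B, hBb, hBc, h.mono (Set.subset_union_left.trans hB),
    h'.mono (Set.subset_union_right.trans hB)⟩

theorem HasBornSum.unique {c : E → 𝕜} {b : E → X} {x x' : X}
    (h : HasBornSum c b x) (h' : HasBornSum c b x') : x = x' := by
  classical
  obtain ⟨D, -, hD, h, h'⟩ := h.common h'
  refine sub_eq_zero.1 (hD.norming _ fun ε hε => ?_)
  obtain ⟨s, hs⟩ := h (ε / 2) (by positivity)
  obtain ⟨s', hs'⟩ := h' (ε / 2) (by positivity)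
  have h1 := hD.isDisk.neg_mem (hs _ (Finset.subset_union_left (s₂ := s')))
  have h2 := hs' _ (Finset.subset_union_right (s₁ := s))
  have h3 := hD.isDisk.add_mem (by positivity) (by positivity) (by positivity) h1 h2
  simpa using h3

theorem HasBornSum.add {c c' : E → 𝕜} {b : E → X} {x x' : X}
    (h : HasBornSum c b x) (h' : HasBornSum c' b x') : HasBornSum (c + c') b (x + x') := by
  classical
  obtain ⟨D, hDb, hD, h, h'⟩ := h.common h'
  refine ⟨D, hDb, fun ε hε => ?_⟩
  obtain ⟨s, hs⟩ := h (ε / 2) (by positivity)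
  obtain ⟨s', hs'⟩ := h' (ε / 2) (by positivity)
  refine ⟨s ∪ s', fun t ht => ?_⟩
  have h1 := hs t (Finset.subset_union_left.trans ht)
  have h2 := hs' t (Finset.subset_union_right.trans ht)
  have h3 := hD.isDisk.add_mem (by positivity) (by positivity) (by positivity) h1 h2
  have h4 : ∑ e ∈ t, (c + c') e • b e - (x + x') =
      (∑ e ∈ t, c e • b e - x) + (∑ e ∈ t, c' e • b e - x') := by
    simp only [Pi.add_apply, add_smul, Finset.sum_add_distrib]
    abel
  rw [h4]
  simpa using h3

theorem HasBornSum.const_smul {c : E → 𝕜} {b : E → X} {x : X}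
    (h : HasBornSum c b x) (a : 𝕜) : HasBornSum (a • c) b (a • x) := by
  obtain ⟨D, hDb, h⟩ := h
  refine ⟨a • D, isBounded_const_smul 𝕜 hDb a, fun ε hε => ?_⟩
  obtain ⟨s, hs⟩ := h ε hε
  refine ⟨s, fun t ht => ?_⟩
  obtain ⟨d, hd, hdx⟩ := hs t ht
  refine ⟨a • d, ⟨d, hd, rfl⟩, ?_⟩
  simp only [Pi.smul_apply, smul_assoc, ← Finset.smul_sum, ← smul_sub, ← hdx]
  exact smul_comm _ _ _

end Sums

/-! ### The free complete bornological space on a bornological set -/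

section Free

variable {𝕜 : Type} [RCLike 𝕜] {E : Type u}

theorem ellOne_summable (f : lp (fun _ : E => 𝕜) 1) : Summable fun e => ‖f e‖ := by
  simpa using (lp.memℓp f).summable (by simp)

theorem ellOne_norm (f : lp (fun _ : E => 𝕜) 1) : ‖f‖ = ∑' e, ‖f e‖ := by
  simpa using lp.norm_eq_tsum_rpow (p := 1) (by simp) f

theorem ellOne_exists_hasSumIn {X : Type u} [AddCommGroup X] [Module 𝕜 X] {b : E → X} {S : Set E} {D : Set X} (hD : IsCompletantDisk 𝕜 D)
    (h0 : (0 : X) ∈ D) (hSD : b '' S ⊆ D) (f : lp (fun _ : E => 𝕜) 1)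
    (hf : Function.support f ⊆ S) : ∃ x, HasSumIn D f b x :=
  hD.exists_hasSumIn h0 (ellOne_summable f) fun e he => hSD ⟨e, hf he, rfl⟩

/-- The absolutely summable families with support in `S`. -/
def supported (S : Set (E)) : Submodule 𝕜 (lp (fun _ : E => 𝕜) 1) where
  carrier := {f | Function.support f ⊆ S}
  add_mem' hf hg := (Function.support_add _ _).trans (Set.union_subset hf hg)
  zero_mem' _ h := absurd rfl h
  smul_mem' c _ hf := (Function.support_const_smul_subset c _).trans hf

theorem isClosed_supported (S : Set (E)) :
    IsClosed (supported (𝕜 := 𝕜) S : Set (lp (fun _ : E => 𝕜) 1)) := by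
  have : (supported (𝕜 := 𝕜) S : Set (lp (fun _ : E => 𝕜) 1)) = ⋂ e ∈ Sᶜ, {f | f e = 0} := by
    ext f
    simp only [Set.mem_iInter, Set.mem_ofPred_eq, SetLike.mem_coe]
    exact ⟨fun h e he => by_contra fun hfe => he (h hfe),
      fun h e hfe => by_contra fun he => hfe (h e he)⟩
  rw [this]
  refine isClosed_biInter fun e _ => isClosed_eq ?_ continuous_const
  exact (continuous_apply e).comp (lp.uniformContinuous_coe.continuous)

variable (𝕜 E) [Bornology E]

/-- The absolutely summable families with bounded support. -/
noncomputable def ellOne : Submodule 𝕜 (lp (fun _ : E => 𝕜) 1) where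
  carrier := {f | IsBounded (Function.support f)}
  add_mem' hf hg := (IsBounded.union hf hg).subset (Function.support_add _ _)
  zero_mem' := isBounded_empty.subset fun _ h => h rfl
  smul_mem' c _ hf := IsBounded.subset hf (Function.support_const_smul_subset c _)

variable {𝕜 E}

/-- The basis vectors. -/
noncomputable def ellOne.single [DecidableEq E] (e : E) : ellOne 𝕜 E :=
  ⟨lp.single 1 e (1 : 𝕜), by
    refine (isBounded_singleton (x := e)).subset fun a ha => ?_
    by_contra h
    exact ha (lp.single_apply_ne 1 e _ h)⟩

/-- A map out of `ellOne` is bounded if it is bounded on the balls with a given bounded support. -/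
def ellOne.IsBoundedMap {X : Type u} [Bornology X] (g : ellOne 𝕜 E → X) : Prop :=
  ∀ S : Set E, IsBounded S → ∀ C : ℝ,
    IsBounded (g '' {f | Function.support (f : lp (fun _ : E => 𝕜) 1) ⊆ S ∧ ‖f‖ ≤ C})

variable {X : Type u} [AddCommGroup X] [Module 𝕜 X] [Bornology X]

theorem ellOne.hasBornSum_of_isBoundedMap [DecidableEq E] (g : ellOne 𝕜 E →ₗ[𝕜] X)
    (hg : ellOne.IsBoundedMap g) (f : ellOne 𝕜 E) :
    HasBornSum (f : lp (fun _ : E => 𝕜) 1) (fun e => g (ellOne.single e)) (g f) := by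
  refine ⟨_, hg _ f.2 1, fun ε hε => ?_⟩
  have h0 : (ε : 𝕜) ≠ 0 := by exact_mod_cast hε.ne'
  have hs := lp.hasSum_single (E := fun _ : E => 𝕜) (p := 1) (by simp) f.1
  obtain ⟨s, hs⟩ := (Metric.tendsto_atTop.1 hs) ε hε
  refine ⟨s, fun t ht => ?_⟩
  have hst := hs t ht
  set r : ellOne 𝕜 E := ∑ e ∈ t, f.1 e • ellOne.single e - f with hr
  have hrv : (r : lp (fun _ : E => 𝕜) 1) = ∑ e ∈ t, lp.single 1 e (f.1 e) - f.1 := by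
    rw [hr, Submodule.coe_sub, Submodule.coe_sum]
    congr 1
    refine Finset.sum_congr rfl fun e _ => ?_
    rw [Submodule.coe_smul, ellOne.single, ← lp.single_smul, smul_eq_mul, mul_one]
  have hrn : ‖r‖ < ε := by
    rw [dist_eq_norm, ← hrv] at hst
    exact hst
  have hrs : Function.support (r : lp (fun _ : E => 𝕜) 1) ⊆ Function.support f.1 := by
    intro a ha
    by_contra hfa
    rw [Function.notMem_support] at hfa
    apply ha
    rw [hrv, lp.coeFn_sub, Pi.sub_apply, hfa, sub_zero, lp.coeFn_sum, Finset.sum_apply]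
    refine Finset.sum_eq_zero fun e _ => ?_
    by_cases hae : a = e
    · subst hae
      rw [hfa, lp.single_zero]; rfl
    · exact lp.single_apply_ne 1 e _ hae
  have hgr : ∑ e ∈ t, f.1 e • g (ellOne.single e) - g f = g r := by
    rw [hr, map_sub, map_sum]
    simp only [map_smul]
  rw [hgr]
  refine ⟨_, ⟨(ε : 𝕜)⁻¹ • r, ⟨?_, ?_⟩, rfl⟩, by simp [smul_smul, mul_inv_cancel₀ h0]⟩
  · exact (Function.support_const_smul_subset _ _).trans hrs
  · rw [norm_smul, norm_inv, RCLike.norm_of_nonneg hε.le, inv_mul_le_iff₀ hε, mul_one]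
    exact hrn.le

variable [CompleteBornologicalSpace 𝕜 X]

theorem ellOne.hom_ext [DecidableEq E] {g h : ellOne 𝕜 E →ₗ[𝕜] X}
    (hg : ellOne.IsBoundedMap g) (hh : ellOne.IsBoundedMap h)
    (H : ∀ e, g (ellOne.single e) = h (ellOne.single e)) : g = h := by
  refine LinearMap.ext fun f => ?_
  have h1 := ellOne.hasBornSum_of_isBoundedMap g hg f
  simp only [H] at h1
  exact h1.unique (ellOne.hasBornSum_of_isBoundedMap h hh f)

theorem ellOne.exists_hasBornSum {b : E → X} (hb : CBorn.IsBoundedMap b) (f : ellOne 𝕜 E) :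
    ∃ x, HasBornSum (f : lp (fun _ : E => 𝕜) 1) b x := by
  obtain ⟨D, hSD, h0, hDb, hD⟩ := exists_completant_zero_mem 𝕜 (hb _ f.2)
  obtain ⟨x, hx⟩ := ellOne_exists_hasSumIn hD h0 hSD f.1 subset_rfl
  exact ⟨x, D, hDb, hx⟩

/-- The linear extension of a bounded map on `E`. -/
noncomputable def ellOne.lift (b : E → X) (hb : CBorn.IsBoundedMap b) : ellOne 𝕜 E →ₗ[𝕜] X where
  toFun f := (ellOne.exists_hasBornSum hb f).choose
  map_add' f g := (ellOne.exists_hasBornSum hb (f + g)).choose_spec.unique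
    ((ellOne.exists_hasBornSum hb f).choose_spec.add (ellOne.exists_hasBornSum hb g).choose_spec)
  map_smul' c f := (ellOne.exists_hasBornSum hb (c • f)).choose_spec.unique
    ((ellOne.exists_hasBornSum hb f).choose_spec.const_smul c)

theorem ellOne.hasBornSum_lift (b : E → X) (hb : CBorn.IsBoundedMap b) (f : ellOne 𝕜 E) :
    HasBornSum (f : lp (fun _ : E => 𝕜) 1) b (ellOne.lift b hb f) :=
  (ellOne.exists_hasBornSum hb f).choose_spec

theorem ellOne.lift_single [DecidableEq E] (b : E → X) (hb : CBorn.IsBoundedMap b) (e : E) :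
    ellOne.lift (𝕜 := 𝕜) b hb (ellOne.single e) = b e := by
  refine (ellOne.hasBornSum_lift b hb (ellOne.single e)).unique ?_
  refine ⟨{0}, isBounded_singleton, fun ε hε => ⟨{e}, fun t ht => ?_⟩⟩
  have he : e ∈ t := ht (Finset.mem_singleton_self e)
  rw [Finset.sum_eq_single_of_mem e he]
  · have : (ellOne.single (𝕜 := 𝕜) e).1 e = 1 := lp.single_apply_self 1 e _
    rw [this, one_smul, sub_self]
    exact ⟨0, rfl, smul_zero _⟩
  · intro a _ hae
    have : (ellOne.single (𝕜 := 𝕜) e).1 a = 0 := lp.single_apply_ne 1 e _ hae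
    rw [this, zero_smul]

theorem ellOne.isBoundedMap_lift (b : E → X) (hb : CBorn.IsBoundedMap b) :
    ellOne.IsBoundedMap (ellOne.lift (𝕜 := 𝕜) b hb) := by
  intro S hS C
  obtain ⟨D, hSD, h0, hDb, hD⟩ := exists_completant_zero_mem 𝕜 (hb _ hS)
  refine (isBounded_const_smul 𝕜 hDb (((max C 0 + 1) + 1 : ℝ) : 𝕜)).subset ?_
  rintro _ ⟨f, ⟨hfS, hfC⟩, rfl⟩
  obtain ⟨x, hx⟩ := ellOne_exists_hasSumIn hD h0 hSD f.1 hfS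
  obtain rfl : ellOne.lift b hb f = x :=
    (ellOne.hasBornSum_lift b hb f).unique ⟨D, hDb, hx⟩
  obtain ⟨s, hs⟩ := hx 1 one_pos
  have h1 := hD.isDisk.neg_mem (hs s subset_rfl)
  have h2 : ∑ e ∈ s, f.1 e • b e ∈ ((max C 0 + 1 : ℝ) : 𝕜) • D := by
    refine hD.isDisk.sum_mem _ _ s (fun e _ he => hSD ⟨e, hfS he, rfl⟩) (by positivity) h0 ?_
    refine ((ellOne_summable f.1).sum_le_tsum s fun _ _ => norm_nonneg _).trans ?_
    rw [← ellOne_norm]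
    have : ‖f.1‖ ≤ C := hfC
    linarith [le_max_left C 0]
  have h3 := hD.isDisk.add_mem (by positivity) zero_le_one (by positivity) h2 h1
  simpa using h3

end Free

end CBorn

namespace CBorn

open Bornology

/-! ### Existence of completed tensor products -/

section Existence

variable {𝕜 : Type} [RCLike 𝕜] {M B N X : Type u}
  [AddCommGroup M] [Module 𝕜 M] [Bornology M] [AddCommGroup B] [Module 𝕜 B]
  [AddCommGroup N] [Module 𝕜 N] [Bornology N] [AddCommGroup X] [Module 𝕜 X] [Bornology X]
  (ρ : M →ₗ[𝕜] B →ₗ[𝕜] M) (l : B →ₗ[𝕜] N →ₗ[𝕜] N)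

theorem IsBoundedMap₂.uncurry {M N X : Type u} [Bornology M] [Bornology N] [Bornology X]
    {β : M → N → X} (h : IsBoundedMap₂ β) : IsBoundedMap (fun p : M × N => β p.1 p.2) :=
  fun s hs => (h _ _ hs.image_fst hs.image_snd).subset (by
    rintro _ ⟨p, hp, rfl⟩
    exact ⟨_, ⟨p, hp, rfl⟩, _, ⟨p, hp, rfl⟩, rfl⟩)

variable {ρ l} in
/-- The extension of a tensorial map to the free complete bornological space. -/
noncomputable def IsTensorial.lift [CompleteBornologicalSpace 𝕜 X] {β : M →ₗ[𝕜] N →ₗ[𝕜] X}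
    (h : IsTensorial ρ l β) : ellOne 𝕜 (M × N) →ₗ[𝕜] X :=
  ellOne.lift (fun p => β p.1 p.2) h.bounded.uncurry

/-- The families that every tensorial map annihilates. -/
def tensorRelations : Submodule 𝕜 (ellOne 𝕜 (M × N)) where
  carrier := {f | ∀ (X : Type u) [AddCommGroup X] [Module 𝕜 X] [Bornology X]
    [CompleteBornologicalSpace 𝕜 X] (β : M →ₗ[𝕜] N →ₗ[𝕜] X) (h : IsTensorial ρ l β), h.lift f = 0}
  add_mem' hf hg X _ _ _ _ β h := by rw [map_add, hf X β h, hg X β h, add_zero]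
  zero_mem' X _ _ _ _ β h := map_zero _
  smul_mem' c f hf X _ _ _ _ β h := by rw [map_smul, hf X β h, smul_zero]

/-- The completed tensor product over `B`. -/
def CompletedTensor : Type u := ellOne 𝕜 (M × N) ⧸ tensorRelations ρ l

namespace CompletedTensor

noncomputable instance : AddCommGroup (CompletedTensor ρ l) :=
  inferInstanceAs (AddCommGroup (ellOne 𝕜 (M × N) ⧸ tensorRelations ρ l))

noncomputable instance : Module 𝕜 (CompletedTensor ρ l) :=
  inferInstanceAs (Module 𝕜 (ellOne 𝕜 (M × N) ⧸ tensorRelations ρ l))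

/-- The quotient map. -/
noncomputable def proj : ellOne 𝕜 (M × N) →ₗ[𝕜] CompletedTensor ρ l :=
  (tensorRelations ρ l).mkQ

theorem proj_surjective : Function.Surjective (proj ρ l) := Submodule.mkQ_surjective _

variable {ρ l} in
theorem proj_eq_zero_iff {f : ellOne 𝕜 (M × N)} : proj ρ l f = 0 ↔
    ∀ (X : Type u) [AddCommGroup X] [Module 𝕜 X] [Bornology X] [CompleteBornologicalSpace 𝕜 X]
    (β : M →ₗ[𝕜] N →ₗ[𝕜] X) (h : IsTensorial ρ l β), h.lift f = 0 :=
  Submodule.Quotient.mk_eq_zero _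

variable {ρ l} in
theorem proj_eq_proj {f g : ellOne 𝕜 (M × N)}
    (H : ∀ (X : Type u) [AddCommGroup X] [Module 𝕜 X] [Bornology X] [CompleteBornologicalSpace 𝕜 X]
    (β : M →ₗ[𝕜] N →ₗ[𝕜] X) (h : IsTensorial ρ l β), h.lift f = h.lift g) :
    proj ρ l f = proj ρ l g := by
  rw [← sub_eq_zero, ← map_sub, proj_eq_zero_iff]
  intro X _ _ _ _ β h
  rw [map_sub, H X β h, sub_self]

/-- The images of the balls with bounded support. -/
def ball (S : Set (M × N)) (C : ℝ) : Set (CompletedTensor ρ l) :=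
  proj ρ l '' {f | Function.support (f : lp (fun _ : M × N => 𝕜) 1) ⊆ S ∧ ‖f‖ ≤ C}

theorem ball_mono {S S' : Set (M × N)} {C C' : ℝ} (hS : S ⊆ S') (hC : C ≤ C') :
    ball ρ l S C ⊆ ball ρ l S' C' :=
  Set.image_mono fun _ hf => ⟨hf.1.trans hS, hf.2.trans hC⟩

instance : Bornology (CompletedTensor ρ l) :=
  Bornology.ofBounded {s | ∃ S : Set (M × N), IsBounded S ∧ ∃ C : ℝ, s ⊆ ball ρ l S C}
    ⟨∅, isBounded_empty, 0, by simp⟩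
    (fun s ⟨S, hS, C, h⟩ t hts => ⟨S, hS, C, hts.trans h⟩)
    (fun s ⟨S, hS, C, h⟩ t ⟨S', hS', C', h'⟩ => ⟨S ∪ S', hS.union hS', max C C',
      Set.union_subset (h.trans (ball_mono ρ l Set.subset_union_left (le_max_left _ _)))
        (h'.trans (ball_mono ρ l Set.subset_union_right (le_max_right _ _)))⟩)
    (fun x => by
      obtain ⟨f, rfl⟩ := proj_surjective ρ l x
      exact ⟨_, f.2, ‖f‖, Set.singleton_subset_iff.2 ⟨f, ⟨subset_rfl, le_rfl⟩, rfl⟩⟩)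

variable {ρ l} in
theorem isBounded_iff {s : Set (CompletedTensor ρ l)} :
    IsBounded s ↔ ∃ S : Set (M × N), IsBounded S ∧ ∃ C : ℝ, s ⊆ ball ρ l S C :=
  isBounded_ofBounded_iff _

/-- The inclusion of the families with support in a bounded set. -/
noncomputable def ofSupported {S : Set (M × N)} (hS : IsBounded S) :
    supported (𝕜 := 𝕜) S →ₗ[𝕜] ellOne 𝕜 (M × N) :=
  Submodule.inclusion fun _ hf => hS.subset hf

theorem isClosed_ker {S : Set (M × N)} (hS : IsBounded S) :
    IsClosed (LinearMap.ker (proj ρ l ∘ₗ ofSupported hS) : Set (supported (𝕜 := 𝕜) S)) := by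
  refine isClosed_of_closure_subset fun f hf => ?_
  rw [SetLike.mem_coe, LinearMap.mem_ker, LinearMap.comp_apply, proj_eq_zero_iff]
  intro X _ _ _ _ β h
  refine eq_zero_of_forall_mem_smul 𝕜 (ellOne.isBoundedMap_lift (𝕜 := 𝕜) _ h.bounded.uncurry S hS 1)
    fun ε hε => ?_
  have h0 : (ε : 𝕜) ≠ 0 := by exact_mod_cast hε.ne'
  obtain ⟨g, hg, hfg⟩ := Metric.mem_closure_iff.1 hf ε hε
  rw [SetLike.mem_coe, LinearMap.mem_ker, LinearMap.comp_apply, proj_eq_zero_iff] at hg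
  refine ⟨_, ⟨ofSupported hS ((ε : 𝕜)⁻¹ • (f - g)), ⟨((ε : 𝕜)⁻¹ • (f - g)).2, ?_⟩, rfl⟩, ?_⟩
  · have : ‖(ε : 𝕜)⁻¹ • (f - g)‖ ≤ 1 := by
      rw [norm_smul, norm_inv, RCLike.norm_of_nonneg hε.le, inv_mul_le_iff₀ hε, mul_one,
        ← dist_eq_norm]
      exact hfg.le
    exact this
  · have := hg X β h
    rw [IsTensorial.lift] at this ⊢
    simp [this, smul_smul, mul_inv_cancel₀ h0]

instance : CompleteBornologicalSpace 𝕜 (CompletedTensor ρ l) where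
  isBounded_add s t hs ht := by
    obtain ⟨S, hS, C, h⟩ := isBounded_iff.1 hs
    obtain ⟨S', hS', C', h'⟩ := isBounded_iff.1 ht
    refine isBounded_iff.2 ⟨S ∪ S', hS.union hS', C + C', ?_⟩
    rintro _ ⟨x, hx, y, hy, rfl⟩
    obtain ⟨f, hf, rfl⟩ := h hx
    obtain ⟨g, hg, rfl⟩ := h' hy
    exact ⟨f + g, ⟨(Function.support_add _ _).trans (Set.union_subset_union hf.1 hg.1),
      (norm_add_le _ _).trans (add_le_add hf.2 hg.2)⟩, map_add _ _ _⟩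
  isBounded_smul Λ s hΛ hs := by
    obtain ⟨S, hS, C, h⟩ := isBounded_iff.1 hs
    obtain ⟨R, hR⟩ := hΛ.exists_norm_le
    refine isBounded_iff.2 ⟨S, hS, R * C, ?_⟩
    rintro _ ⟨c, hc, x, hx, rfl⟩
    obtain ⟨f, hf, rfl⟩ := h hx
    refine ⟨c • f, ⟨(Function.support_const_smul_subset _ _).trans hf.1, ?_⟩, map_smul _ _ _⟩
    rw [norm_smul]
    exact mul_le_mul (hR c hc) hf.2 (norm_nonneg _) ((norm_nonneg c).trans (hR c hc))
  exists_completant s hs := by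
    obtain ⟨S, hS, C, h⟩ := isBounded_iff.1 hs
    have := (isClosed_supported (𝕜 := 𝕜) S).completeSpace_coe
    obtain ⟨D, hD, hD', hDc⟩ := exists_isCompletantDisk_of_isClosed_ker
      (proj ρ l ∘ₗ ofSupported hS) (isClosed_ker ρ l hS) (show 0 < max C 0 + 1 by positivity)
    refine ⟨D, fun x hx => hD ?_, isBounded_iff.2 ⟨S, hS, max C 0 + 1 + 1, hD'.trans ?_⟩, hDc⟩
    · obtain ⟨f, hf, rfl⟩ := h hx
      refine ⟨⟨f.1, hf.1⟩, mem_closedBall_zero_iff.2 ?_, rfl⟩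
      have : ‖f‖ ≤ max C 0 + 1 := by linarith [hf.2, le_max_left C 0]
      exact this
    · rintro _ ⟨f, hf, rfl⟩
      exact ⟨ofSupported hS f, ⟨f.2, mem_closedBall_zero_iff.1 hf⟩, rfl⟩

open Classical in
/-- The universal tensorial map. -/
noncomputable def mk : M →ₗ[𝕜] N →ₗ[𝕜] CompletedTensor ρ l :=
  LinearMap.mk₂ 𝕜 (fun m n => proj ρ l (ellOne.single (m, n)))
    (fun m m' n => by
      rw [← map_add]
      refine proj_eq_proj fun X _ _ _ _ β h => ?_
      simp only [map_add, IsTensorial.lift, ellOne.lift_single, LinearMap.add_apply])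
    (fun c m n => by
      rw [← map_smul]
      refine proj_eq_proj fun X _ _ _ _ β h => ?_
      simp only [map_smul, IsTensorial.lift, ellOne.lift_single, LinearMap.smul_apply])
    (fun m n n' => by
      rw [← map_add]
      refine proj_eq_proj fun X _ _ _ _ β h => ?_
      simp only [map_add, IsTensorial.lift, ellOne.lift_single])
    (fun c m n => by
      rw [← map_smul]
      refine proj_eq_proj fun X _ _ _ _ β h => ?_
      simp only [map_smul, IsTensorial.lift, ellOne.lift_single])

open Classical in
theorem isTensorial_mk : IsTensorial ρ l (mk ρ l) where
  bounded s t hs ht := by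
    refine isBounded_iff.2 ⟨s ×ˢ t, hs.prod ht, 1, ?_⟩
    rintro _ ⟨m, hm, n, hn, rfl⟩
    refine ⟨ellOne.single (m, n), ⟨fun e he => ?_, ?_⟩, rfl⟩
    · obtain rfl : e = (m, n) := by
        by_contra h
        exact he (lp.single_apply_ne (E := fun _ : M × N => 𝕜) 1 (m, n) (1 : 𝕜) h)
      exact ⟨hm, hn⟩
    · have : ‖lp.single (E := fun _ : M × N => 𝕜) 1 (m, n) (1 : 𝕜)‖ = 1 := by
        rw [lp.norm_single (by simp), norm_one]
      exact this.le
  balanced m b n := by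
    refine proj_eq_proj fun X _ _ _ _ β h => ?_
    simp only [IsTensorial.lift, ellOne.lift_single, h.balanced]

open Classical in
theorem isTensorProductOver : IsTensorProductOver ρ l (mk ρ l) where
  complete := inferInstance
  tensorial := isTensorial_mk ρ l
  universal X _ _ _ _ β h := by
    have hle : tensorRelations ρ l ≤ LinearMap.ker h.lift := fun f hf => hf X β h
    refine ⟨(tensorRelations ρ l).liftQ h.lift hle, ⟨fun s hs => ?_, fun m n => ?_⟩, ?_⟩
    · obtain ⟨S, hS, C, hsS⟩ := isBounded_iff.1 hs
      refine (ellOne.isBoundedMap_lift (𝕜 := 𝕜) _ h.bounded.uncurry S hS C).subset ?_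
      rintro _ ⟨x, hx, rfl⟩
      obtain ⟨f, hf, rfl⟩ := hsS hx
      exact ⟨f, hf, rfl⟩
    · exact ellOne.lift_single (fun p : M × N => β p.1 p.2) h.bounded.uncurry (m, n)
    · rintro g ⟨hg, hgβ⟩
      have key : g ∘ₗ proj ρ l = h.lift := by
        refine ellOne.hom_ext (fun S hS C => ?_) (ellOne.isBoundedMap_lift _ _) fun e => ?_
        · refine (hg _ (isBounded_iff.2 ⟨S, hS, C, subset_rfl⟩)).subset ?_
          rintro _ ⟨f, hf, rfl⟩
          exact ⟨_, ⟨f, hf, rfl⟩, rfl⟩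
        · rw [IsTensorial.lift, ellOne.lift_single, ← hgβ]
          rfl
      refine LinearMap.ext fun x => ?_
      obtain ⟨f, rfl⟩ := proj_surjective ρ l x
      exact LinearMap.congr_fun key f

end CompletedTensor

end Existence

end CBorn

namespace CBorn

open Bornology

/-! ### Formal properties of tensor products -/

namespace IsTensorProductOver

variable {𝕜 : Type} [RCLike 𝕜] {M B N C K T U W X : Type u}
  [AddCommGroup M] [Module 𝕜 M] [Bornology M] [AddCommGroup B] [Module 𝕜 B]
  [AddCommGroup N] [Module 𝕜 N] [Bornology N] [AddCommGroup C] [Module 𝕜 C]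
  [AddCommGroup K] [Module 𝕜 K] [Bornology K] [AddCommGroup T] [Module 𝕜 T] [Bornology T]
  [AddCommGroup U] [Module 𝕜 U] [Bornology U] [AddCommGroup W] [Module 𝕜 W] [Bornology W]
  [AddCommGroup X] [Module 𝕜 X] [Bornology X]
  {ρ : M →ₗ[𝕜] B →ₗ[𝕜] M} {l : B →ₗ[𝕜] N →ₗ[𝕜] N} {τ : M →ₗ[𝕜] N →ₗ[𝕜] T}

theorem flip (h : IsTensorProductOver ρ l τ) : IsTensorProductOver l.flip ρ.flip τ.flip where
  complete := h.complete
  tensorial := ⟨h.tensorial.bounded.flip, fun n b m => (h.tensorial.balanced m b n).symm⟩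
  universal Y _ _ _ _ β hβ := by
    obtain ⟨f, ⟨hf, hfβ⟩, huniq⟩ := h.universal Y β.flip
      ⟨hβ.bounded.flip, fun m b n => (hβ.balanced n b m).symm⟩
    exact ⟨f, ⟨hf, fun n m => hfβ m n⟩, fun g hg => huniq g ⟨hg.1, fun m n => hg.2 n m⟩⟩

theorem hom_ext [CompleteBornologicalSpace 𝕜 X] (h : IsTensorProductOver ρ l τ)
    {f g : T →ₗ[𝕜] X} (hf : IsBoundedMap f) (hg : IsBoundedMap g)
    (H : ∀ m n, f (τ m n) = g (τ m n)) : f = g :=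
  (h.universal X (τ.compr₂ g) ⟨hg.comp₂ h.tensorial.bounded, fun m b n => by
    simp [h.tensorial.balanced]⟩).unique ⟨hf, H⟩ ⟨hg, fun _ _ => rfl⟩

/-- Tensorial maps that depend linearly on a parameter, boundedly in all three variables, induce a
bounded bilinear map. -/
theorem exists_lift₂ [CompleteBornologicalSpace 𝕜 X] (h : IsTensorProductOver ρ l τ)
    (θ : K →ₗ[𝕜] M →ₗ[𝕜] N →ₗ[𝕜] X)
    (hb : ∀ (r : Set K) (s : Set M) (t : Set N), IsBounded r → IsBounded s → IsBounded t →
      ∃ D : Set X, IsBounded D ∧ ∀ k ∈ r, ∀ m ∈ s, ∀ n ∈ t, θ k m n ∈ D)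
    (hbal : ∀ k m b n, θ k (ρ m b) n = θ k m (l b n)) :
    ∃ Θ : T →ₗ[𝕜] K →ₗ[𝕜] X, IsBoundedMap₂ (fun t k => Θ t k) ∧
      ∀ m n k, Θ (τ m n) k = θ k m n := by
  have hk : ∀ k, ∃ f : T →ₗ[𝕜] X, IsBoundedMap f ∧ ∀ m n, f (τ m n) = θ k m n := fun k => by
    refine (h.universal X (θ k) ⟨fun s t hs ht => ?_, hbal k⟩).exists
    obtain ⟨D, hD, hDm⟩ := hb {k} s t isBounded_singleton hs ht
    exact hD.subset (by rintro _ ⟨m, hm, n, hn, rfl⟩; exact hDm k rfl m hm n hn)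
  choose f hf hfθ using hk
  let F : K →ₗ[𝕜] T →ₗ[𝕜] X :=
    { toFun := f
      map_add' := fun k k' => h.hom_ext (hf _) (isBoundedMap_add (hf k) (hf k'))
        fun m n => by simp [hfθ]
      map_smul' := fun c k => h.hom_ext (hf _) (isBoundedMap_smul (hf k) c)
        fun m n => by simp [hfθ] }
  refine ⟨F.flip, ?_, fun m n k => hfθ k m n⟩
  intro s r hs hr
  have hrange : ∀ m n, IsBounded (Set.range fun k : r => θ k m n) := fun m n => by
    obtain ⟨D, hD, hDm⟩ := hb r {m} {n} hr isBounded_singleton isBounded_singleton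
    exact hD.subset (by rintro _ ⟨k, rfl⟩; exact hDm k k.2 m rfl n rfl)
  let β : M →ₗ[𝕜] N →ₗ[𝕜] UniformFunctions 𝕜 r X :=
    LinearMap.mk₂ 𝕜 (fun m n => UniformFunctions.mk _ (hrange m n))
      (fun m m' n => UniformFunctions.ext fun k => by simp)
      (fun c m n => UniformFunctions.ext fun k => by simp)
      (fun m n n' => UniformFunctions.ext fun k => by simp)
      (fun c m n => UniformFunctions.ext fun k => by simp)
  have hβ : ∀ m n k, UniformFunctions.eval k (β m n) = θ k m n := fun m n k => by simp [β]
  obtain ⟨g, hg, hgβ⟩ := (h.universal _ β ⟨fun s t hs ht => by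
    obtain ⟨D, hD, hDm⟩ := hb r s t hr hs ht
    refine UniformFunctions.isBounded_iff.2 ⟨D, hD, ?_⟩
    rintro _ ⟨m, hm, n, hn, rfl⟩ k
    exact hβ m n k ▸ hDm k k.2 m hm n hn, fun m b n => UniformFunctions.ext fun k => by
      rw [hβ, hβ, hbal]⟩).exists
  have hgf : ∀ k : r, UniformFunctions.eval k ∘ₗ g = f k := fun k =>
    h.hom_ext ((UniformFunctions.isBoundedMap_eval k).comp hg) (hf k) fun m n => by
      rw [LinearMap.comp_apply, hgβ, hβ, hfθ]
  obtain ⟨D, hD, hDs⟩ := UniformFunctions.isBounded_iff.1 (hg s hs)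
  refine hD.subset ?_
  rintro _ ⟨t, ht, k, hk, rfl⟩
  have := hDs _ ⟨t, ht, rfl⟩ ⟨k, hk⟩
  rwa [show UniformFunctions.eval (⟨k, hk⟩ : r) (g t) = f k t from
    LinearMap.congr_fun (hgf ⟨k, hk⟩) t] at this

/-- Associativity: if `T` is the tensor product of `M` and `N` over `B`, and `U` is that of `N` and
`K` over `C`, then a tensor product of `T` and `K` over `C` is one of `M` and `U` over `B`. -/
theorem assoc {r : N →ₗ[𝕜] C →ₗ[𝕜] N} {l' : C →ₗ[𝕜] K →ₗ[𝕜] K} {rT : T →ₗ[𝕜] C →ₗ[𝕜] T}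
    {σ : N →ₗ[𝕜] K →ₗ[𝕜] U} {lU : B →ₗ[𝕜] U →ₗ[𝕜] U} {ω : T →ₗ[𝕜] K →ₗ[𝕜] W}
    {α : M →ₗ[𝕜] U →ₗ[𝕜] W}
    (hτ : IsTensorProductOver ρ l τ) (hσ : IsTensorProductOver r l' σ)
    (hω : IsTensorProductOver rT l' ω)
    (hrT : ∀ m n c, rT (τ m n) c = τ m (r n c)) (hrTb : ∀ c, IsBoundedMap fun t => rT t c)
    (hlU : ∀ b n k, lU b (σ n k) = σ (l b n) k) (hlUb : ∀ b, IsBoundedMap (lU b))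
    (hαb : IsBoundedMap₂ fun m u => α m u) (hα : ∀ m n k, α m (σ n k) = ω (τ m n) k) :
    IsTensorProductOver ρ lU α := by
  have := hω.complete
  have := hτ.complete
  refine ⟨hω.complete, ⟨hαb, fun m b u => ?_⟩, fun X _ _ _ _ β hβ => ?_⟩
  · have : α (ρ m b) = α m ∘ₗ lU b :=
      hσ.hom_ext (hαb.apply_left _) ((hαb.apply_left m).comp (hlUb b)) fun n k => by
        rw [LinearMap.comp_apply, hlU, hα, hα, hτ.tensorial.balanced]
    exact LinearMap.congr_fun this u
  · let θ : K →ₗ[𝕜] M →ₗ[𝕜] N →ₗ[𝕜] X := LinearMap.mk₂ 𝕜 (fun k m => β m ∘ₗ σ.flip k)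
      (fun k k' m => LinearMap.ext fun n => by simp)
      (fun c k m => LinearMap.ext fun n => by simp)
      (fun k m m' => LinearMap.ext fun n => by simp)
      (fun c k m => LinearMap.ext fun n => by simp)
    have hθ : ∀ k m n, θ k m n = β m (σ n k) := fun k m n => rfl
    obtain ⟨Θ, hΘb, hΘ⟩ := hτ.exists_lift₂ θ (fun r s t hr hs ht =>
        ⟨_, hβ.bounded s _ hs (hσ.tensorial.bounded t r ht hr), fun k hk m hm n hn =>
          ⟨m, hm, _, ⟨n, hn, k, hk, rfl⟩, rfl⟩⟩)
      (fun k m b n => by rw [hθ, hθ, hβ.balanced, hlU])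
    obtain ⟨g, hg, hgω⟩ := (hω.universal X Θ ⟨hΘb, fun t c k => by
      have : Θ.flip k ∘ₗ rT.flip c = Θ.flip (l' c k) :=
        hτ.hom_ext ((hΘb.apply_right k).comp (hrTb c)) (hΘb.apply_right _) fun m n => by
          rw [LinearMap.comp_apply, LinearMap.flip_apply, LinearMap.flip_apply, LinearMap.flip_apply,
            hrT, hΘ, hΘ, hθ, hθ, hσ.tensorial.balanced]
      exact LinearMap.congr_fun this t⟩).exists
    refine ⟨g, ⟨hg, fun m u => ?_⟩, fun g' ⟨hg', hgα'⟩ => ?_⟩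
    · have : g ∘ₗ α m = β m :=
        hσ.hom_ext (hg.comp (hαb.apply_left m)) (hβ.bounded.apply_left m) fun n k => by
          rw [LinearMap.comp_apply, hα, hgω, hΘ, hθ]
      exact LinearMap.congr_fun this u
    · refine hω.hom_ext hg' hg fun t k => ?_
      have : g' ∘ₗ ω.flip k = g ∘ₗ ω.flip k :=
        hτ.hom_ext (hg'.comp (hω.tensorial.bounded.apply_right k))
          (hg.comp (hω.tensorial.bounded.apply_right k)) fun m n => by
          simp only [LinearMap.comp_apply, LinearMap.flip_apply]
          rw [hgω, ← hα, hgα', hΘ, hθ]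
      exact LinearMap.congr_fun this t

theorem assoc' {r : N →ₗ[𝕜] C →ₗ[𝕜] N} {l' : C →ₗ[𝕜] K →ₗ[𝕜] K} {rT : T →ₗ[𝕜] C →ₗ[𝕜] T}
    {σ : N →ₗ[𝕜] K →ₗ[𝕜] U} {lU : B →ₗ[𝕜] U →ₗ[𝕜] U} {ω : M →ₗ[𝕜] U →ₗ[𝕜] W}
    {α : T →ₗ[𝕜] K →ₗ[𝕜] W}
    (hτ : IsTensorProductOver ρ l τ) (hσ : IsTensorProductOver r l' σ)
    (hω : IsTensorProductOver ρ lU ω)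
    (hrT : ∀ m n c, rT (τ m n) c = τ m (r n c)) (hrTb : ∀ c, IsBoundedMap fun t => rT t c)
    (hlU : ∀ b n k, lU b (σ n k) = σ (l b n) k) (hlUb : ∀ b, IsBoundedMap (lU b))
    (hαb : IsBoundedMap₂ fun t k => α t k) (hα : ∀ m n k, α (τ m n) k = ω m (σ n k)) :
    IsTensorProductOver rT l' α :=
  (hσ.flip.assoc (α := α.flip) (lU := rT.flip) (rT := lU.flip) hτ.flip hω.flip
    (fun k n b => hlU b n k) hlUb (fun c n m => hrT m n c) hrTb hαb.flip
    (fun k n m => hα m n k)).flip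

theorem congr_right {N' : Type u} [AddCommGroup N'] [Module 𝕜 N'] [Bornology N']
    (h : IsTensorProductOver ρ l τ) {l' : B →ₗ[𝕜] N' →ₗ[𝕜] N'} (φ : N' →ₗ[𝕜] N) (ψ : N →ₗ[𝕜] N')
    (hφ : IsBoundedMap φ) (hψ : IsBoundedMap ψ) (hφψ : ∀ n, φ (ψ n) = n) (hψφ : ∀ n, ψ (φ n) = n)
    (hl : ∀ b n, φ (l' b n) = l b (φ n)) : IsTensorProductOver ρ l' (τ.compl₂ φ) where
  complete := h.complete
  tensorial := ⟨h.tensorial.bounded.comp isBoundedMap_id hφ, fun m b n => by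
    simp [h.tensorial.balanced, hl]⟩
  universal X _ _ _ _ β hβ := by
    obtain ⟨f, ⟨hf, hfβ⟩, huniq⟩ := h.universal X (β.compl₂ ψ)
      ⟨hβ.bounded.comp isBoundedMap_id hψ, fun m b n => by
        rw [LinearMap.compl₂_apply, LinearMap.compl₂_apply, hβ.balanced, ← hψφ (l' b (ψ n)), hl,
          hφψ]⟩
    refine ⟨f, ⟨hf, fun m n => by simp [hfβ, hψφ]⟩, fun g hg => huniq g ⟨hg.1, fun m n => ?_⟩⟩
    have := hg.2 m (ψ n)
    rwa [LinearMap.compl₂_apply, hφψ] at this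

theorem congr_left {M' : Type u} [AddCommGroup M'] [Module 𝕜 M'] [Bornology M']
    (h : IsTensorProductOver ρ l τ) {ρ' : M' →ₗ[𝕜] B →ₗ[𝕜] M'} (φ : M' →ₗ[𝕜] M) (ψ : M →ₗ[𝕜] M')
    (hφ : IsBoundedMap φ) (hψ : IsBoundedMap ψ) (hφψ : ∀ n, φ (ψ n) = n) (hψφ : ∀ n, ψ (φ n) = n)
    (hρ : ∀ m b, φ (ρ' m b) = ρ (φ m) b) : IsTensorProductOver ρ' l (τ ∘ₗ φ) :=
  (h.flip.congr_right (l' := ρ'.flip) φ ψ hφ hψ hφψ hψφ fun b m => hρ m b).flip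

end IsTensorProductOver

end CBorn

namespace CBorn

open Bornology

/-! ### Composition of smooth bimodules -/

section Composition

variable {𝕜 : Type} [RCLike 𝕜] {A B C : Type u}
  [NonUnitalRing A] [Module 𝕜 A] [Bornology A] [CompleteBornologicalAlgebra 𝕜 A]
  [NonUnitalRing B] [Module 𝕜 B] [Bornology B] [CompleteBornologicalAlgebra 𝕜 B]
  [NonUnitalRing C] [Module 𝕜 C] [Bornology C] [CompleteBornologicalAlgebra 𝕜 C]

theorem exists_isComposite (P : SmoothBimodule 𝕜 A B) (Q : SmoothBimodule 𝕜 B C) :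
    ∃ (T : SmoothBimodule 𝕜 A C) (τ : P.carrier →ₗ[𝕜] Q.carrier →ₗ[𝕜] T.carrier),
      IsComposite P Q T τ := by
  let τ := CompletedTensor.mk P.ract Q.lact
  have hτ : IsTensorProductOver P.ract Q.lact τ := CompletedTensor.isTensorProductOver P.ract Q.lact
  obtain ⟨L, hLb, hL⟩ := hτ.exists_lift₂ (P.lact.compr₂ τ)
    (fun r s t hr hs ht => ⟨_, hτ.tensorial.bounded _ t (P.bounded_lact r s hr hs) ht,
      fun a ha p hp q hq => ⟨_, ⟨a, ha, p, hp, rfl⟩, q, hq, rfl⟩⟩)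
    (fun a p b q => by
      simp only [LinearMap.compr₂_apply]
      rw [← P.lact_ract, hτ.tensorial.balanced])
  obtain ⟨R, hRb, hR⟩ := hτ.flip.exists_lift₂ (Q.ract.flip.compr₂ τ.flip)
    (fun r s t hr hs ht => ⟨_, hτ.tensorial.bounded t _ ht (Q.bounded_ract s r hs hr),
      fun c hc q hq p hp => ⟨p, hp, _, ⟨q, hq, c, hc, rfl⟩, rfl⟩⟩)
    (fun c q b p => by
      simp only [LinearMap.compr₂_apply, LinearMap.flip_apply]
      rw [hτ.tensorial.balanced, Q.lact_ract])
  simp only [LinearMap.compr₂_apply, LinearMap.flip_apply] at hL hR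
  refine ⟨{ carrier := CompletedTensor P.ract Q.lact
            lact := L.flip
            ract := R
            bounded_lact := hLb.flip
            bounded_ract := hRb
            mul_lact := fun a a' t => ?_
            ract_mul := fun t c c' => ?_
            lact_ract := fun a t c => ?_
            smooth_left := ?_
            smooth_right := ?_ }, τ, hτ, fun a p q => (hL p q a).symm, fun p q c => (hR q p c).symm⟩
  · have : L.flip (a * a') = L.flip a ∘ₗ L.flip a' :=
      hτ.hom_ext (hLb.apply_right _) ((hLb.apply_right a).comp (hLb.apply_right a')) fun p q => by
        simp only [LinearMap.comp_apply, LinearMap.flip_apply, hL, P.mul_lact]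
    exact LinearMap.congr_fun this t
  · have : R.flip (c * c') = R.flip c' ∘ₗ R.flip c :=
      hτ.hom_ext (hRb.apply_right _) ((hRb.apply_right c').comp (hRb.apply_right c)) fun p q => by
        simp only [LinearMap.comp_apply, LinearMap.flip_apply, hR, Q.ract_mul]
    exact LinearMap.congr_fun this t
  · have : R.flip c ∘ₗ L.flip a = L.flip a ∘ₗ R.flip c :=
      hτ.hom_ext ((hRb.apply_right c).comp (hLb.apply_right a))
        ((hLb.apply_right a).comp (hRb.apply_right c)) fun p q => by
        simp only [LinearMap.comp_apply, LinearMap.flip_apply, hR, hL]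
    exact LinearMap.congr_fun this t
  · exact P.smooth_left.assoc hτ hτ (fun a p b => P.lact_ract a p b)
      (fun b => P.bounded_ract.apply_right b) (fun a p q => hL p q a)
      (fun a => hLb.apply_right a) hLb.flip (fun a p q => hL p q a)
  · exact hτ.assoc' Q.smooth_right hτ (fun p q c => hR q p c)
      (fun c => hRb.apply_right c) (fun b q c => (Q.lact_ract b q c).symm)
      (fun b => Q.bounded_lact.apply_left b) hRb (fun p q c => hR q p c)

namespace SmoothBimodule

theorem hom_ext {M N : SmoothBimodule 𝕜 A B} {f g : M ⟶ N}
    (h : ∀ m, f.toLinearMap m = g.toLinearMap m) : f = g :=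
  SmoothBimodule.Hom.ext (LinearMap.ext h)

@[simp]
theorem id_apply (M : SmoothBimodule 𝕜 A B) (m : M.carrier) :
    SmoothBimodule.Hom.toLinearMap (𝟙 M) m = m := rfl

@[simp]
theorem comp_apply {M N K : SmoothBimodule 𝕜 A B} (f : M ⟶ N) (g : N ⟶ K) (m : M.carrier) :
    SmoothBimodule.Hom.toLinearMap (f ≫ g) m = g.toLinearMap (f.toLinearMap m) := rfl

@[simp]
theorem hom_inv_apply {M N : SmoothBimodule 𝕜 A B} (e : M ≅ N) (m : M.carrier) :
    e.inv.toLinearMap (e.hom.toLinearMap m) = m := by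
  rw [← comp_apply, e.hom_inv_id, id_apply]

@[simp]
theorem inv_hom_apply {M N : SmoothBimodule 𝕜 A B} (e : M ≅ N) (n : N.carrier) :
    e.hom.toLinearMap (e.inv.toLinearMap n) = n :=
  hom_inv_apply e.symm n

end SmoothBimodule

namespace IsComposite

variable {P : SmoothBimodule 𝕜 A B} {Q : SmoothBimodule 𝕜 B C} {T T' X : SmoothBimodule 𝕜 A C}
  {τ : P.carrier →ₗ[𝕜] Q.carrier →ₗ[𝕜] T.carrier} {τ' : P.carrier →ₗ[𝕜] Q.carrier →ₗ[𝕜] T'.carrier}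

theorem hom_ext (h : IsComposite P Q T τ) {f g : T ⟶ X}
    (H : ∀ p q, f.toLinearMap (τ p q) = g.toLinearMap (τ p q)) : f = g :=
  SmoothBimodule.Hom.ext (h.isTensorProduct.hom_ext f.bounded g.bounded H)

theorem exists_hom (h : IsComposite P Q T τ) (β : P.carrier →ₗ[𝕜] Q.carrier →ₗ[𝕜] X.carrier)
    (hβ : IsTensorial P.ract Q.lact β) (hl : ∀ a p q, β (P.lact a p) q = X.lact a (β p q))
    (hr : ∀ p q c, β p (Q.ract q c) = X.ract (β p q) c) :
    ∃ f : T ⟶ X, ∀ p q, f.toLinearMap (τ p q) = β p q := by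
  obtain ⟨f, hf, hfβ⟩ := (h.isTensorProduct.universal X.carrier β hβ).exists
  refine ⟨⟨f, hf, fun a t => ?_, fun t c => ?_⟩, hfβ⟩
  · have : f ∘ₗ T.lact a = X.lact a ∘ₗ f :=
      h.isTensorProduct.hom_ext (hf.comp (T.bounded_lact.apply_left a))
        ((X.bounded_lact.apply_left a).comp hf) fun p q => by
        simp only [LinearMap.comp_apply]
        rw [← h.map_lact, hfβ, hfβ, hl]
    exact LinearMap.congr_fun this t
  · have : f ∘ₗ T.ract.flip c = X.ract.flip c ∘ₗ f :=
      h.isTensorProduct.hom_ext (hf.comp (T.bounded_ract.apply_right c))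
        ((X.bounded_ract.apply_right c).comp hf) fun p q => by
        simp only [LinearMap.comp_apply, LinearMap.flip_apply]
        rw [← h.map_ract, hfβ, hfβ, hr]
    exact LinearMap.congr_fun this t

theorem exists_iso (h : IsComposite P Q T τ) (h' : IsComposite P Q T' τ') :
    ∃ e : T ≅ T', ∀ p q, e.hom.toLinearMap (τ p q) = τ' p q := by
  obtain ⟨f, hf⟩ := h.exists_hom τ' h'.isTensorProduct.tensorial h'.map_lact h'.map_ract
  obtain ⟨g, hg⟩ := h'.exists_hom τ h.isTensorProduct.tensorial h.map_lact h.map_ract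
  exact ⟨⟨f, g, h.hom_ext fun p q => by simp [hf, hg], h'.hom_ext fun p q => by simp [hf, hg]⟩, hf⟩

end IsComposite

/-- The composite of two smooth bimodules. -/
noncomputable def tensorObj (P : SmoothBimodule 𝕜 A B) (Q : SmoothBimodule 𝕜 B C) :
    SmoothBimodule 𝕜 A C :=
  (exists_isComposite P Q).choose

/-- The universal tensorial map to the composite of two smooth bimodules. -/
noncomputable def tensorMk (P : SmoothBimodule 𝕜 A B) (Q : SmoothBimodule 𝕜 B C) :
    P.carrier →ₗ[𝕜] Q.carrier →ₗ[𝕜] (tensorObj P Q).carrier :=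
  (exists_isComposite P Q).choose_spec.choose

theorem isComposite_tensorMk (P : SmoothBimodule 𝕜 A B) (Q : SmoothBimodule 𝕜 B C) :
    IsComposite P Q (tensorObj P Q) (tensorMk P Q) :=
  (exists_isComposite P Q).choose_spec.choose_spec

theorem exists_tensorMap {P P' : SmoothBimodule 𝕜 A B} {Q Q' : SmoothBimodule 𝕜 B C}
    (f : P ⟶ P') (g : Q ⟶ Q') : ∃ h : tensorObj P Q ⟶ tensorObj P' Q', ∀ p q,
      h.toLinearMap (tensorMk P Q p q) = tensorMk P' Q' (f.toLinearMap p) (g.toLinearMap q) := by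
  have h' := isComposite_tensorMk P' Q'
  refine (isComposite_tensorMk P Q).exists_hom
    ((tensorMk P' Q').compl₁₂ f.toLinearMap g.toLinearMap)
    ⟨h'.isTensorProduct.tensorial.bounded.comp f.bounded g.bounded, fun p b q => ?_⟩
    (fun a p q => ?_) fun p q c => ?_
  · simp only [LinearMap.compl₁₂_apply]
    rw [f.map_ract, g.map_lact, h'.isTensorProduct.tensorial.balanced]
  · simp only [LinearMap.compl₁₂_apply]
    rw [f.map_lact, h'.map_lact]
  · simp only [LinearMap.compl₁₂_apply]
    rw [g.map_ract, h'.map_ract]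

/-- The composite of two bimodule maps. -/
noncomputable def tensorMap {P P' : SmoothBimodule 𝕜 A B} {Q Q' : SmoothBimodule 𝕜 B C}
    (f : P ⟶ P') (g : Q ⟶ Q') : tensorObj P Q ⟶ tensorObj P' Q' :=
  (exists_tensorMap f g).choose

@[simp]
theorem tensorMap_tensorMk {P P' : SmoothBimodule 𝕜 A B} {Q Q' : SmoothBimodule 𝕜 B C}
    (f : P ⟶ P') (g : Q ⟶ Q') (p : P.carrier) (q : Q.carrier) :
    (tensorMap f g).toLinearMap (tensorMk P Q p q) =
      tensorMk P' Q' (f.toLinearMap p) (g.toLinearMap q) :=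
  (exists_tensorMap f g).choose_spec p q

/-- Composition with `P` on the right. -/
@[simps]
noncomputable def tensorRight (C : Type u) [NonUnitalRing C] [Module 𝕜 C] [Bornology C]
    [CompleteBornologicalAlgebra 𝕜 C] (P : SmoothBimodule 𝕜 A B) :
    SmoothBimodule 𝕜 C A ⥤ SmoothBimodule 𝕜 C B where
  obj X := tensorObj X P
  map f := tensorMap f (𝟙 P)
  map_id X := (isComposite_tensorMk X P).hom_ext fun x p => by simp
  map_comp {X _ _} f g := (isComposite_tensorMk X P).hom_ext fun x p => by simp

/-- Composition with `P` on the left. -/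
@[simps]
noncomputable def tensorLeft (C : Type u) [NonUnitalRing C] [Module 𝕜 C] [Bornology C]
    [CompleteBornologicalAlgebra 𝕜 C] (P : SmoothBimodule 𝕜 A B) :
    SmoothBimodule 𝕜 B C ⥤ SmoothBimodule 𝕜 A C where
  obj X := tensorObj P X
  map f := tensorMap (𝟙 P) f
  map_id X := (isComposite_tensorMk P X).hom_ext fun p x => by simp
  map_comp {X _ _} f g := (isComposite_tensorMk P X).hom_ext fun p x => by simp

theorem tensor_tensor_hom_ext_left {D : Type u} [NonUnitalRing D] [Module 𝕜 D] [Bornology D]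
    [CompleteBornologicalAlgebra 𝕜 D] {X : SmoothBimodule 𝕜 A B} {P : SmoothBimodule 𝕜 B C}
    {Q : SmoothBimodule 𝕜 C D} {Y : SmoothBimodule 𝕜 A D} {f g : tensorObj (tensorObj X P) Q ⟶ Y}
    (H : ∀ x p q, f.toLinearMap (tensorMk _ Q (tensorMk X P x p) q) =
      g.toLinearMap (tensorMk _ Q (tensorMk X P x p) q)) : f = g := by
  refine (isComposite_tensorMk _ Q).hom_ext fun t q => ?_
  have hb := (isComposite_tensorMk (tensorObj X P) Q).isTensorProduct.tensorial.bounded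
  have : f.toLinearMap ∘ₗ (tensorMk _ Q).flip q = g.toLinearMap ∘ₗ (tensorMk _ Q).flip q :=
    (isComposite_tensorMk X P).isTensorProduct.hom_ext (f.bounded.comp (hb.apply_right q))
      (g.bounded.comp (hb.apply_right q)) fun x p => H x p q
  exact LinearMap.congr_fun this t

theorem tensor_tensor_hom_ext_right {D : Type u} [NonUnitalRing D] [Module 𝕜 D] [Bornology D]
    [CompleteBornologicalAlgebra 𝕜 D] {P : SmoothBimodule 𝕜 A B} {Q : SmoothBimodule 𝕜 B C}
    {X : SmoothBimodule 𝕜 C D} {Y : SmoothBimodule 𝕜 A D} {f g : tensorObj P (tensorObj Q X) ⟶ Y}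
    (H : ∀ p q x, f.toLinearMap (tensorMk P _ p (tensorMk Q X q x)) =
      g.toLinearMap (tensorMk P _ p (tensorMk Q X q x))) : f = g := by
  refine (isComposite_tensorMk P _).hom_ext fun p t => ?_
  have hb := (isComposite_tensorMk P (tensorObj Q X)).isTensorProduct.tensorial.bounded
  have : f.toLinearMap ∘ₗ tensorMk P _ p = g.toLinearMap ∘ₗ tensorMk P _ p :=
    (isComposite_tensorMk Q X).isTensorProduct.hom_ext (f.bounded.comp (hb.apply_left p))
      (g.bounded.comp (hb.apply_left p)) fun q x => H p q x
  exact LinearMap.congr_fun this t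

variable [SelfInduced 𝕜 A]

theorem isComposite_lact (P : SmoothBimodule 𝕜 A B) :
    IsComposite (regular 𝕜 A) P P P.lact where
  isTensorProduct := P.smooth_left
  map_lact a a' p := P.mul_lact a a' p
  map_ract a p b := (P.lact_ract a p b).symm

variable {P : SmoothBimodule 𝕜 A B} {Q : SmoothBimodule 𝕜 B A} {T : SmoothBimodule 𝕜 A A}
  {τ : P.carrier →ₗ[𝕜] Q.carrier →ₗ[𝕜] T.carrier}

theorem exists_isComposite_tensorRight (h : IsComposite P Q T τ) (e : T ≅ regular 𝕜 A)
    (X : SmoothBimodule 𝕜 C A) :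
    ∃ α : (tensorObj X P).carrier →ₗ[𝕜] Q.carrier →ₗ[𝕜] X.carrier,
      IsComposite (tensorObj X P) Q X α ∧
      ∀ x p q, α (tensorMk X P x p) q = X.ract x (e.hom.toLinearMap (τ p q)) := by
  have hX := isComposite_tensorMk X P
  let φ : T.carrier →ₗ[𝕜] A := e.hom.toLinearMap
  let ψ : A →ₗ[𝕜] T.carrier := e.inv.toLinearMap
  have hφl : ∀ a t, φ (T.lact a t) = a * φ t := e.hom.map_lact
  have hφr : ∀ t a, φ (T.ract t a) = φ t * a := e.hom.map_ract
  have hω : IsTensorProductOver X.ract T.lact (X.ract.compl₂ φ) :=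
    X.smooth_right.congr_right φ ψ e.hom.bounded e.inv.bounded
      (SmoothBimodule.inv_hom_apply e) (SmoothBimodule.hom_inv_apply e) hφl
  let θ : Q.carrier →ₗ[𝕜] X.carrier →ₗ[𝕜] P.carrier →ₗ[𝕜] X.carrier :=
    LinearMap.mk₂ 𝕜 (fun q x => X.ract x ∘ₗ φ ∘ₗ τ.flip q)
      (fun q q' x => LinearMap.ext fun p => by simp)
      (fun c q x => LinearMap.ext fun p => by simp)
      (fun q x x' => LinearMap.ext fun p => by simp)
      (fun c q x => LinearMap.ext fun p => by simp)
  have hθ : ∀ q x p, θ q x p = X.ract x (φ (τ p q)) := fun q x p => rfl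
  obtain ⟨α, hαb, hα⟩ := hX.isTensorProduct.exists_lift₂ θ
    (fun r s t hr hs ht => ⟨_, X.bounded_ract s _ hs
      (e.hom.bounded _ (h.isTensorProduct.tensorial.bounded t r ht hr)),
      fun q hq x hx p hp => ⟨x, hx, _, ⟨_, ⟨p, hp, q, hq, rfl⟩, rfl⟩, rfl⟩⟩)
    (fun q x a p => by rw [hθ, hθ, h.map_lact, hφl, X.ract_mul])
  refine ⟨α, ⟨?_, fun c t q => ?_, fun t q a => ?_⟩, fun x p q => (hα x p q).trans (hθ q x p)⟩
  · exact hX.isTensorProduct.assoc' h.isTensorProduct hω (fun x p b => (hX.map_ract x p b).symm)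
      (fun b => (tensorObj X P).bounded_ract.apply_right b) (fun a p q => (h.map_lact a p q).symm)
      (fun a => T.bounded_lact.apply_left a) hαb (fun x p q => hα x p q)
  · have : α.flip q ∘ₗ (tensorObj X P).lact c = X.lact c ∘ₗ α.flip q :=
      hX.isTensorProduct.hom_ext
        ((hαb.apply_right q).comp ((tensorObj X P).bounded_lact.apply_left c))
        ((X.bounded_lact.apply_left c).comp (hαb.apply_right q)) fun x p => by
        simp only [LinearMap.comp_apply, LinearMap.flip_apply]
        rw [← hX.map_lact, hα, hα, hθ, hθ, X.lact_ract]
    exact LinearMap.congr_fun this t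
  · have : α.flip (Q.ract q a) = X.ract.flip a ∘ₗ α.flip q :=
      hX.isTensorProduct.hom_ext (hαb.apply_right _)
        ((X.bounded_ract.apply_right a).comp (hαb.apply_right q)) fun x p => by
        simp only [LinearMap.comp_apply, LinearMap.flip_apply]
        rw [hα, hα, hθ, hθ, h.map_ract, hφr, X.ract_mul]
    exact LinearMap.congr_fun this t

theorem exists_isComposite_tensorLeft (h : IsComposite P Q T τ) (e : T ≅ regular 𝕜 A)
    (X : SmoothBimodule 𝕜 A C) :
    ∃ α : P.carrier →ₗ[𝕜] (tensorObj Q X).carrier →ₗ[𝕜] X.carrier,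
      IsComposite P (tensorObj Q X) X α ∧
      ∀ p q x, α p (tensorMk Q X q x) = X.lact (e.hom.toLinearMap (τ p q)) x := by
  have hX := isComposite_tensorMk Q X
  let φ : T.carrier →ₗ[𝕜] A := e.hom.toLinearMap
  let ψ : A →ₗ[𝕜] T.carrier := e.inv.toLinearMap
  have hφl : ∀ a t, φ (T.lact a t) = a * φ t := e.hom.map_lact
  have hφr : ∀ t a, φ (T.ract t a) = φ t * a := e.hom.map_ract
  have hω : IsTensorProductOver T.ract X.lact (X.lact ∘ₗ φ) :=
    X.smooth_left.congr_left φ ψ e.hom.bounded e.inv.bounded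
      (SmoothBimodule.inv_hom_apply e) (SmoothBimodule.hom_inv_apply e) hφr
  let θ : P.carrier →ₗ[𝕜] Q.carrier →ₗ[𝕜] X.carrier →ₗ[𝕜] X.carrier :=
    τ.compr₂ (X.lact ∘ₗ φ)
  have hθ : ∀ p q x, θ p q x = X.lact (φ (τ p q)) x := fun p q x => rfl
  obtain ⟨α, hαb, hα⟩ := hX.isTensorProduct.exists_lift₂ θ
    (fun r s t hr hs ht => ⟨_, X.bounded_lact _ t
      (e.hom.bounded _ (h.isTensorProduct.tensorial.bounded r s hr hs)) ht,
      fun p hp q hq x hx => ⟨_, ⟨_, ⟨p, hp, q, hq, rfl⟩, rfl⟩, x, hx, rfl⟩⟩)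
    (fun p q a x => by rw [hθ, hθ, h.map_ract, hφr, X.mul_lact])
  refine ⟨α.flip, ⟨?_, fun a p t => ?_, fun p t c => ?_⟩,
    fun p q x => (hα q x p).trans (hθ p q x)⟩
  · exact h.isTensorProduct.assoc hX.isTensorProduct hω (fun p q a => (h.map_ract p q a).symm)
      (fun a => T.bounded_ract.apply_right a) (fun b q x => (hX.map_lact b q x).symm)
      (fun b => (tensorObj Q X).bounded_lact.apply_left b) hαb.flip (fun p q x => hα q x p)
  · have : α.flip (P.lact a p) = X.lact a ∘ₗ α.flip p :=
      hX.isTensorProduct.hom_ext (hαb.apply_right _)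
        ((X.bounded_lact.apply_left a).comp (hαb.apply_right p)) fun q x => by
        simp only [LinearMap.comp_apply, LinearMap.flip_apply]
        rw [hα, hα, hθ, hθ, h.map_lact, hφl, X.mul_lact]
    exact LinearMap.congr_fun this t
  · have : α.flip p ∘ₗ (tensorObj Q X).ract.flip c = X.ract.flip c ∘ₗ α.flip p :=
      hX.isTensorProduct.hom_ext
        ((hαb.apply_right p).comp ((tensorObj Q X).bounded_ract.apply_right c))
        ((X.bounded_ract.apply_right c).comp (hαb.apply_right p)) fun q x => by
        simp only [LinearMap.comp_apply, LinearMap.flip_apply]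
        rw [← hX.map_ract, hα, hα, hθ, hθ, X.lact_ract]
    exact LinearMap.congr_fun this t

theorem exists_tensorRight_iso (h : IsComposite P Q T τ) (e : T ≅ regular 𝕜 A)
    (X : SmoothBimodule 𝕜 C A) :
    ∃ i : tensorObj (tensorObj X P) Q ≅ X, ∀ x p q,
      i.hom.toLinearMap (tensorMk _ Q (tensorMk X P x p) q) =
        X.ract x (e.hom.toLinearMap (τ p q)) := by
  obtain ⟨α, hα, hαm⟩ := exists_isComposite_tensorRight h e X
  obtain ⟨i, hi⟩ := (isComposite_tensorMk _ Q).exists_iso hα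
  exact ⟨i, fun x p q => by rw [hi, hαm]⟩

theorem exists_tensorLeft_iso (h : IsComposite P Q T τ) (e : T ≅ regular 𝕜 A)
    (X : SmoothBimodule 𝕜 A C) :
    ∃ i : tensorObj P (tensorObj Q X) ≅ X, ∀ p q x,
      i.hom.toLinearMap (tensorMk P _ p (tensorMk Q X q x)) =
        X.lact (e.hom.toLinearMap (τ p q)) x := by
  obtain ⟨α, hα, hαm⟩ := exists_isComposite_tensorLeft h e X
  obtain ⟨i, hi⟩ := (isComposite_tensorMk P _).exists_iso hα
  exact ⟨i, fun p q x => by rw [hi, hαm]⟩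

theorem nonempty_tensorRight_comp_iso (h : IsComposite P Q T τ) (e : T ≅ regular 𝕜 A) :
    Nonempty (tensorRight C P ⋙ tensorRight C Q ≅ 𝟭 (SmoothBimodule 𝕜 C A)) := by
  choose i hi using exists_tensorRight_iso (C := C) h e
  refine ⟨NatIso.ofComponents i fun {X Y} f => tensor_tensor_hom_ext_left fun x p q => ?_⟩
  change (i Y).hom.toLinearMap ((tensorMap (tensorMap f (𝟙 P)) (𝟙 Q)).toLinearMap
    (tensorMk _ Q (tensorMk X P x p) q)) = f.toLinearMap ((i X).hom.toLinearMap _)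
  rw [tensorMap_tensorMk, tensorMap_tensorMk, hi, hi]
  exact (f.map_ract _ _).symm

theorem nonempty_tensorLeft_comp_iso (h : IsComposite P Q T τ) (e : T ≅ regular 𝕜 A) :
    Nonempty (tensorLeft C Q ⋙ tensorLeft C P ≅ 𝟭 (SmoothBimodule 𝕜 A C)) := by
  choose i hi using exists_tensorLeft_iso (C := C) h e
  refine ⟨NatIso.ofComponents i fun {X Y} f => tensor_tensor_hom_ext_right fun p q x => ?_⟩
  change (i Y).hom.toLinearMap ((tensorMap (𝟙 P) (tensorMap (𝟙 Q) f)).toLinearMap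
    (tensorMk P _ p (tensorMk Q X q x))) = f.toLinearMap ((i X).hom.toLinearMap _)
  rw [tensorMap_tensorMk, tensorMap_tensorMk, hi, hi]
  exact (f.map_lact _ _).symm

variable {S : SmoothBimodule 𝕜 B B} {σ : Q.carrier →ₗ[𝕜] P.carrier →ₗ[𝕜] S.carrier}

theorem isEquivalence_tensorRight [SelfInduced 𝕜 B] (h : IsComposite P Q T τ)
    (e : T ≅ regular 𝕜 A) (h' : IsComposite Q P S σ) (e' : S ≅ regular 𝕜 B) :
    (tensorRight C P).IsEquivalence := by
  obtain ⟨i⟩ := nonempty_tensorRight_comp_iso (C := C) h e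
  obtain ⟨j⟩ := nonempty_tensorRight_comp_iso (C := C) h' e'
  exact (CategoryTheory.Equivalence.mk (tensorRight C P) (tensorRight C Q) i.symm
    j).isEquivalence_functor

theorem isEquivalence_tensorLeft [SelfInduced 𝕜 B] (h : IsComposite P Q T τ)
    (e : T ≅ regular 𝕜 A) (h' : IsComposite Q P S σ) (e' : S ≅ regular 𝕜 B) :
    (tensorLeft C Q).IsEquivalence := by
  obtain ⟨i⟩ := nonempty_tensorLeft_comp_iso (C := C) h e
  obtain ⟨j⟩ := nonempty_tensorLeft_comp_iso (C := C) h' e'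
  exact (CategoryTheory.Equivalence.mk (tensorLeft C Q) (tensorLeft C P) i.symm
    j).isEquivalence_functor

end Composition

end CBorn

namespace CBorn

/-! ### Strong subobjects under equivalences of categories -/

section Subobjects

universe v w v' w'

variable {C : Type w} [Category.{v} C] {D : Type w'} [Category.{v'} D]

theorem strongMono_map_of_isEquivalence (F : C ⥤ D) [F.IsEquivalence] {X Y : C} (f : X ⟶ Y)
    [StrongMono f] : StrongMono (F.map f) where
  mono := inferInstance
  rlp _ _ z _ := (F.asEquivalence.symm.toAdjunction.hasLiftingProperty_iff z f).1
    (StrongMono.rlp (F.asEquivalence.inverse.map z))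

theorem strongMono_map_iff (F : C ⥤ D) [F.IsEquivalence] {X Y : C} (f : X ⟶ Y) :
    StrongMono (F.map f) ↔ StrongMono f := by
  refine ⟨fun h => ?_, fun h => strongMono_map_of_isEquivalence F f⟩
  have := strongMono_map_of_isEquivalence F.inv (F.map f)
  exact (StrongMono.iff_of_arrow_iso (Arrow.isoMk (F.asEquivalence.unitIso.app X)
    (F.asEquivalence.unitIso.app Y) (F.asEquivalence.unitIso.hom.naturality f).symm)).2 this

theorem strongMono_arrow_mk_iff {X Y : C} (f : X ⟶ Y) [Mono f] :
    StrongMono (Subobject.mk f).arrow ↔ StrongMono f :=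
  StrongMono.iff_of_arrow_iso (Arrow.isoMk (Subobject.underlyingIso f) (Iso.refl Y) (by simp))

/-- The order isomorphism on subobjects induced by an equivalence of categories. -/
noncomputable def subobjectOrderIso (F : C ⥤ D) [F.IsEquivalence] {X : C} {Y : D}
    (e : F.obj X ≅ Y) : Subobject X ≃o Subobject Y :=
  (Subobject.lowerEquivalence
    ((MonoOver.congr X F.asEquivalence).trans (MonoOver.mapIso e))).toOrderIso

theorem subobjectOrderIso_mk (F : C ⥤ D) [F.IsEquivalence] {X : C} {Y : D}
    (e : F.obj X ≅ Y) {Z : C} (f : Z ⟶ X) [Mono f] :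
    subobjectOrderIso F e (Subobject.mk f) = Subobject.mk (F.map f ≫ e.hom) := rfl

theorem strongMono_arrow_subobjectOrderIso (F : C ⥤ D) [F.IsEquivalence] {X : C} {Y : D}
    (e : F.obj X ≅ Y) (I : Subobject X) :
    StrongMono (subobjectOrderIso F e I).arrow ↔ StrongMono I.arrow := by
  conv_lhs => rw [← Subobject.mk_arrow I, subobjectOrderIso_mk]
  rw [strongMono_arrow_mk_iff, ← strongMono_map_iff F I.arrow]
  exact StrongMono.iff_of_arrow_iso (Arrow.isoMk (Iso.refl _) e.symm (by simp))

theorem nonempty_iso_subobjectOrderIso (F : C ⥤ D) [F.IsEquivalence] {X : C} {Y : D}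
    (e : F.obj X ≅ Y) (I : Subobject X) :
    Nonempty ((subobjectOrderIso F e I : D) ≅ F.obj (I : C)) := by
  conv => rw [← Subobject.mk_arrow I, subobjectOrderIso_mk]
  exact ⟨Subobject.underlyingIso _ ≪≫ F.mapIso (Subobject.underlyingIso I.arrow).symm⟩

theorem isZero_of_isZero_obj (F : C ⥤ D) [F.Full] [F.Faithful] {X : C}
    (h : Limits.IsZero (F.obj X)) : Limits.IsZero X :=
  ⟨fun _ => ⟨⟨⟨F.preimage (h.to_ _)⟩, fun _ => F.map_injective (h.eq_of_src _ _)⟩⟩,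
    fun _ => ⟨⟨⟨F.preimage (h.from_ _)⟩, fun _ => F.map_injective (h.eq_of_tgt _ _)⟩⟩⟩

theorem isZero_obj_iff (F : C ⥤ D) [F.IsEquivalence] (X : C) :
    Limits.IsZero (F.obj X) ↔ Limits.IsZero X :=
  ⟨isZero_of_isZero_obj F, fun h => isZero_of_isZero_obj F.inv
    (h.of_iso (F.asEquivalence.unitIso.app X).symm)⟩

end Subobjects

section Ideals

variable {𝕜 : Type} [RCLike 𝕜] {A B : Type u}
  [NonUnitalRing A] [Module 𝕜 A] [Bornology A] [CompleteBornologicalAlgebra 𝕜 A]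
  [NonUnitalRing B] [Module 𝕜 B] [Bornology B] [CompleteBornologicalAlgebra 𝕜 B]

theorem SmoothBimodule.isZero_iff (M : SmoothBimodule 𝕜 A B) :
    Limits.IsZero M ↔ Subsingleton M.carrier := by
  constructor
  · intro h
    let z : M ⟶ M := ⟨0, isBoundedMap_zero, fun a m => by simp, fun m b => by simp⟩
    have hz : 𝟙 M = z := h.eq_of_src _ _
    have : ∀ m : M.carrier, m = 0 := fun m => by
      rw [← SmoothBimodule.id_apply M m, hz]
      rfl
    exact ⟨fun m m' => by rw [this m, this m']⟩
  · intro h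
    refine ⟨fun N => ⟨⟨⟨⟨0, isBoundedMap_zero, fun a m => by simp, fun m b => by simp⟩⟩,
      fun f => SmoothBimodule.hom_ext fun m => ?_⟩⟩,
      fun N => ⟨⟨⟨⟨0, isBoundedMap_zero, fun a m => by simp, fun m b => by simp⟩⟩,
      fun f => SmoothBimodule.hom_ext fun m => Subsingleton.elim _ _⟩⟩⟩
    rw [Subsingleton.elim m 0, map_zero, map_zero]

variable [SelfInduced 𝕜 A] [SelfInduced 𝕜 B]

theorem MoritaEquivalent.exists_equivalence (h : MoritaEquivalent 𝕜 A B) :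
    ∃ F : SmoothBimodule 𝕜 A A ⥤ SmoothBimodule 𝕜 B B,
      F.IsEquivalence ∧ Nonempty (F.obj (regular 𝕜 A) ≅ regular 𝕜 B) := by
  obtain ⟨P, Q, ⟨T, τ, hT, ⟨e⟩⟩, S, σ, hS, ⟨e'⟩⟩ := h
  have := isEquivalence_tensorRight (C := A) hT e hS e'
  have := isEquivalence_tensorLeft (C := B) hT e hS e'
  obtain ⟨i, -⟩ := (isComposite_tensorMk _ P).exists_iso (isComposite_lact P)
  obtain ⟨j, -⟩ := (isComposite_tensorMk Q P).exists_iso hS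
  exact ⟨tensorRight A P ⋙ tensorLeft B Q, inferInstance,
    ⟨(tensorLeft B Q).mapIso i ≪≫ j ≪≫ e'⟩⟩

end Ideals

end CBorn

theorem proposition6 (𝕜 : Type) [RCLike 𝕜] (A B : Type u)
    [NonUnitalRing A] [Module 𝕜 A] [Bornology A] [CBorn.CompleteBornologicalAlgebra 𝕜 A]
    [CBorn.SelfInduced 𝕜 A]
    [NonUnitalRing B] [Module 𝕜 B] [Bornology B] [CBorn.CompleteBornologicalAlgebra 𝕜 B]
    [CBorn.SelfInduced 𝕜 B]
    (h : CBorn.MoritaEquivalent 𝕜 A B) :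
    Nonempty (CBorn.SmoothIdeal 𝕜 A ≃o CBorn.SmoothIdeal 𝕜 B) ∧
      (CBorn.IsSimpleAlg 𝕜 A ↔ CBorn.IsSimpleAlg 𝕜 B) := by
  obtain ⟨F, hF, ⟨e⟩⟩ := h.exists_equivalence
  have hstrong := CBorn.strongMono_arrow_subobjectOrderIso F e
  have hsub : ∀ I : Subobject (CBorn.regular 𝕜 A),
      Subsingleton (CBorn.subobjectOrderIso F e I : CBorn.SmoothBimodule 𝕜 B B).carrier ↔
        Subsingleton (I : CBorn.SmoothBimodule 𝕜 A A).carrier := fun I => by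
    obtain ⟨i⟩ := CBorn.nonempty_iso_subobjectOrderIso F e I
    rw [← CBorn.SmoothBimodule.isZero_iff, ← CBorn.SmoothBimodule.isZero_iff, i.isZero_iff,
      CBorn.isZero_obj_iff]
  let Φ : CBorn.SmoothIdeal 𝕜 A ≃o CBorn.SmoothIdeal 𝕜 B :=
    { toEquiv := (CBorn.subobjectOrderIso F e).toEquiv.subtypeEquiv fun I => (hstrong I).symm
      map_rel_iff' := (CBorn.subobjectOrderIso F e).map_rel_iff }
  refine ⟨⟨Φ⟩, ?_⟩
  rw [CBorn.IsSimpleAlg, CBorn.IsSimpleAlg, Φ.surjective.forall]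
  refine forall_congr' fun I => ?_
  exact (or_congr (hsub I.1) (map_eq_top_iff (CBorn.subobjectOrderIso F e))).symm
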